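/- **Theorem 3.1** (an elliptic Kajihara transformation). Fix $p,q\in\mathbb C$ with $|p|<1$ and $q\neq 0$, and for $x\ne 0$ put $$\theta(x)=\prod_{j=0}^\infty(1-p^jx)(1-p^{j+1}/x),\qquad (a)_k=\theta(a)\theta(aq)\cdots\theta(aq^{k-1}),$$ $$\Delta(z)=\prod_{1\le j<k\le n}z_j\,\theta(z_k/z_j)\qquad\text{for } z=(z_1,\dots,z_n),\qquad zq^y=(z_1q^{y_1},\dots,z_nq^{y_n}).$$ Let $m,n\ge 1$ and $N\ge 0$ be integers, and let $z_1,\dots,z_n$, $w_1,\dots,w_m$, $a_1,\dots,a_{m+n}$ be non-zero complex numbers with $$w_1\cdots w_m=z_1\cdots z_n\,a_1\cdots a_{m+n}.$$ Assume that the parameters are such that no denominator below vanishes, that is, $\Delta(z)\ne0$, $\Delta(w)\neq 0$, $(w_jz_k)_N\ne 0$ for $1\le j\le m$, $1\le k\le n$, $(qz_k/z_j)_N\neq 0$ for $1\le j,k\le n$, and $(qw_k/w_j)_N\ne0$ for $1\le j,k\le m$. Then $$\sum_{\substack{y_1,\dots,y_n\geq 0\\y_1+\dots+y_n=N}} \frac{\Delta(zq^y)}{\Delta(z)}\prod_{k=1}^n\frac{\prod_{j=1}^{m+n}(a_jz_k)_{y_k}}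 {\prod_{j=1}^m(w_jz_k)_{y_k}\prod_{j=1}^n(qz_k/z_j)_{y_k}} =\sum_{\substack{y_1,\dots,y_m\geq 0\\y_1+\dots+y_m=N}} \frac{\Delta(wq^y)}{\Delta(w)} \prod_{k=1}^m\frac{\prod_{j=1}^{m+n}(w_k/a_j)_{y_k}} {\prod_{j=1}^n(w_kz_j)_{y_k}\prod_{j=1}^m(qw_k/w_j)_{y_k}}.$$ -/

import Mathlib

open Finset

noncomputable section

/-- The theta function `θ(x) = ∏_{j ≥ 0} (1 - p ^ j x) (1 - p ^ (j + 1) / x)` of nome `p`;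
the product converges for `|p| < 1` and `x ≠ 0`. -/
def ellTheta (p x : ℂ) : ℂ :=
  ∏' j : ℕ, (1 - p ^ j * x) * (1 - p ^ (j + 1) / x)

/-- The elliptic Pochhammer symbol `(a)_k = θ(a) θ(aq) ⋯ θ(aq ^ (k - 1))`. -/
def ellPoch (p q a : ℂ) (k : ℕ) : ℂ :=
  ∏ i ∈ range k, ellTheta p (a * q ^ i)

/-- The elliptic Weyl denominator `Δ(z) = ∏_{j < k} z_j θ(z_k / z_j)`. -/
def ellDelta (p : ℂ) {n : ℕ} (z : Fin n → ℂ) : ℂ :=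
  ∏ j : Fin n, ∏ k ∈ Ioi j, z j * ellTheta p (z k / z j)

/-- The infinite product defining the theta function is genuinely convergent. -/
theorem ellTheta_multipliable {p : ℂ} (hp : ‖p‖ < 1) (x : ℂ) :
    Multipliable fun j : ℕ => (1 - p ^ j * x) * (1 - p ^ (j + 1) / x) := by
  have hs : Summable fun j : ℕ => ‖p‖ ^ j := summable_geometric_of_lt_one (norm_nonneg p) hp
  have h1 : Multipliable fun j : ℕ => 1 + -(p ^ j * x) := by
    apply multipliable_one_add_of_summable
    simpa using hs.mul_right ‖x‖
  have h2 : Multipliable fun j : ℕ => 1 + -(p ^ (j + 1) / x) := by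
    apply multipliable_one_add_of_summable
    simpa [pow_succ, mul_div_assoc] using hs.mul_right (‖p‖ / ‖x‖)
  simpa [sub_eq_add_neg] using h1.mul h2

end

/-! Both sides satisfy one and the same recursion in the degree, so induction on `N` proves them
equal. Write S_N(z, w, a) for the left side (`kajiharaSum`); the right side is S_N(w, z, 1/a). Fix
an index i and let C_l be `kajiharaCoeff`, formed with a_i replaced by a_i/q^M. For either side
T_M(w, a), with z held fixed, θ(q^(M+1)) T_(M+1)(w, a) = Σ_l C_l T_M(w with w_l → q w_l, a with a_i
→ q a_i). The shift preserves the balancing condition, and in degree 0 both sides equal 1. The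
recursions are `sum_kajiharaCoeff_mul_left` and `sum_kajiharaCoeff_mul_right`.

Both recursions come from the elliptic partial fraction identity `sum_prod_ellTheta_div_eq_zero`,
used in the dual form `sum_prod_ellTheta_div_eq_sum`. It writes θ(q^(M+1)) times a term of degree
M+1 as a sum over the ways to lower one summation index, and the resulting double sum is rearranged
by degree M. Partial fractions follow by induction from the three-term addition formula
`ellTheta_addition`. That formula is a Plücker relation: the Jacobi triple product shows that
θ(xy)θ(x/y) is a form of rank two.

The recursions divide by theta values involving a_i, which the theorem does not assume to be
nonzero. Deforming a_i → a_i s, a_j → a_j/s keeps the balance and avoids these zeros for all but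
countably many s; continuity at s = 1 then gives the general case. -/

noncomputable section

/-! ### Theta function: zeros, inversion, continuity. -/

/-- The infinite product `∏_{j ≥ 1} (1 - p ^ j x)`. -/
def shiftedPochInf (p x : ℂ) : ℂ := ∏' j : ℕ, (1 - p ^ (j + 1) * x)

lemma summable_norm_pow_succ_mul {p : ℂ} (hp : ‖p‖ < 1) (x : ℂ) :
    Summable fun j : ℕ => ‖-(p ^ (j + 1) * x)‖ := by
  have hs : Summable fun j : ℕ => ‖p‖ ^ j := summable_geometric_of_lt_one (norm_nonneg p) hp
  simpa [pow_succ, mul_assoc] using hs.mul_right (‖p‖ * ‖x‖)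

lemma multipliable_one_sub_pow_succ_mul {p : ℂ} (hp : ‖p‖ < 1) (x : ℂ) :
    Multipliable fun j : ℕ => 1 - p ^ (j + 1) * x := by
  simpa [sub_eq_add_neg] using
    multipliable_one_add_of_summable (summable_norm_pow_succ_mul hp x)

lemma shiftedPochInf_eq_zero_iff {p : ℂ} (hp : ‖p‖ < 1) {x : ℂ} :
    shiftedPochInf p x = 0 ↔ ∃ j : ℕ, p ^ (j + 1) * x = 1 := by
  constructor
  · intro h
    by_contra! hne
    refine tprod_one_add_ne_zero_of_summable (f := fun j : ℕ => -(p ^ (j + 1) * x)) (fun j => ?_)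
      (summable_norm_pow_succ_mul hp x) ?_
    · rw [← sub_eq_add_neg, sub_ne_zero]
      exact (hne j).symm
    · simpa [shiftedPochInf, sub_eq_add_neg] using h
  · rintro ⟨j, hj⟩
    exact tprod_of_exists_eq_zero ⟨j, by rw [hj, sub_self]⟩

lemma shiftedPochInf_one_ne_zero {p : ℂ} (hp : ‖p‖ < 1) : shiftedPochInf p 1 ≠ 0 := by
  rw [Ne, shiftedPochInf_eq_zero_iff hp]
  rintro ⟨j, hj⟩
  rw [mul_one] at hj
  have h := pow_lt_one₀ (norm_nonneg p) hp (Nat.succ_ne_zero j)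
  rw [← norm_pow, Nat.succ_eq_add_one, hj, norm_one] at h
  exact lt_irrefl _ h

lemma continuous_shiftedPochInf {p : ℂ} (hp : ‖p‖ < 1) : Continuous (shiftedPochInf p) := by
  rw [← continuousOn_univ]
  have key : HasProdLocallyUniformlyOn (fun (j : ℕ) (x : ℂ) => 1 + -(p ^ (j + 1) * x))
      (fun x => ∏' j : ℕ, (1 + -(p ^ (j + 1) * x))) Set.univ := by
    apply hasProdLocallyUniformlyOn_of_forall_compact isOpen_univ
    intro K _ hK
    obtain ⟨C, hC⟩ := hK.isBounded.exists_norm_le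
    have hs : Summable fun j : ℕ => ‖p‖ ^ (j + 1) * C :=
      ((summable_nat_add_iff 1).mpr (summable_geometric_of_lt_one (norm_nonneg p) hp)).mul_right C
    refine hs.hasProdUniformlyOn_nat_one_add hK (.of_forall fun j x hx => ?_)
      (fun j => by fun_prop)
    rw [norm_neg, norm_mul, norm_pow]
    exact mul_le_mul_of_nonneg_left (hC x hx) (by positivity)
  have := key.tendstoLocallyUniformlyOn_finsetRange.continuousOn
    (.of_forall fun n => by fun_prop)
  simpa [shiftedPochInf, sub_eq_add_neg] using! this

/-- Reduces zeros, inversion and continuity to one product that converges for every argument. -/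
lemma ellTheta_eq {p : ℂ} (hp : ‖p‖ < 1) (x : ℂ) :
    ellTheta p x = (1 - x) * shiftedPochInf p x * shiftedPochInf p x⁻¹ := by
  have h1 := multipliable_one_sub_pow_succ_mul hp x
  have h2 := multipliable_one_sub_pow_succ_mul hp x⁻¹
  have h0 : Multipliable fun j : ℕ => 1 - p ^ j * x := by
    simpa [sub_eq_add_neg] using multipliable_one_add_of_summable
      (f := fun j : ℕ => -(p ^ j * x))
      (by simpa using (summable_geometric_of_lt_one (norm_nonneg p) hp).mul_right ‖x‖)
  have h3 : ∏' j : ℕ, (1 - p ^ j * x) = (1 - x) * shiftedPochInf p x := by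
    have := tprod_eq_zero_mul' (f := fun j : ℕ => 1 - p ^ j * x) h1
    rw [this, pow_zero, one_mul, shiftedPochInf]
  rw [← h3, shiftedPochInf, ← h0.tprod_mul h2, ellTheta]
  simp only [div_eq_mul_inv]

lemma ellTheta_one (p : ℂ) : ellTheta p 1 = 0 :=
  tprod_of_exists_eq_zero ⟨0, by simp⟩

lemma ellTheta_inv {p : ℂ} (hp : ‖p‖ < 1) {x : ℂ} (hx : x ≠ 0) :
    ellTheta p x⁻¹ = -ellTheta p x / x := by
  rw [ellTheta_eq hp, ellTheta_eq hp, inv_inv]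
  field_simp
  ring

lemma ellTheta_div_comm {p : ℂ} (hp : ‖p‖ < 1) {x y : ℂ} (hx : x ≠ 0) (hy : y ≠ 0) :
    ellTheta p (y / x) = -(y / x) * ellTheta p (x / y) := by
  rw [← inv_div, ellTheta_inv hp (div_ne_zero hx hy)]
  field_simp

lemma continuousAt_ellTheta {p : ℂ} (hp : ‖p‖ < 1) {x : ℂ} (hx : x ≠ 0) :
    ContinuousAt (ellTheta p) x := by
  have hc := continuous_shiftedPochInf hp
  rw [show ellTheta p = fun x => (1 - x) * shiftedPochInf p x * shiftedPochInf p x⁻¹ from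
    funext (ellTheta_eq hp)]
  exact ((continuousAt_const.sub continuousAt_id).mul hc.continuousAt).mul
    (hc.continuousAt.comp (continuousAt_inv₀ hx))

/-- This includes p = 0: then `p ^ k` vanishes for k ≠ 0, so x ≠ 0 leaves only x = 1. -/
lemma ellTheta_eq_zero_iff {p : ℂ} (hp : ‖p‖ < 1) {x : ℂ} (hx : x ≠ 0) :
    ellTheta p x = 0 ↔ ∃ k : ℤ, x = p ^ k := by
  rw [ellTheta_eq hp, mul_eq_zero, mul_eq_zero, shiftedPochInf_eq_zero_iff hp,
    shiftedPochInf_eq_zero_iff hp]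
  constructor
  · rintro ((h | ⟨j, hj⟩) | ⟨j, hj⟩)
    · exact ⟨0, by rw [zpow_zero]; linear_combination -h⟩
    · refine ⟨-((j + 1 : ℕ) : ℤ), ?_⟩
      rw [zpow_neg, zpow_natCast]
      exact eq_inv_of_mul_eq_one_right hj
    · refine ⟨((j + 1 : ℕ) : ℤ), ?_⟩
      rw [zpow_natCast]
      field_simp at hj
      exact hj.symm
  · rintro ⟨k, rfl⟩
    rcases k with (_ | j) | j
    · simp
    · right
      refine ⟨j, ?_⟩
      rw [Int.ofNat_eq_natCast, zpow_natCast] at hx ⊢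
      exact mul_inv_cancel₀ hx
    · left; right
      refine ⟨j, ?_⟩
      rw [zpow_negSucc] at hx ⊢
      exact mul_inv_cancel₀ (fun h => hx (by rw [h, inv_zero]))

/-- The zeros form a multiplicative group. This later guarantees a usable pair among any three nodes
of a partial fraction. -/
lemma ellTheta_div_eq_zero {p : ℂ} (hp : ‖p‖ < 1) {x y : ℂ} (hx : x ≠ 0) (hy : y ≠ 0)
    (h1 : ellTheta p x = 0) (h2 : ellTheta p y = 0) : ellTheta p (x / y) = 0 := by
  obtain ⟨k, rfl⟩ := (ellTheta_eq_zero_iff hp hx).mp h1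
  obtain ⟨l, rfl⟩ := (ellTheta_eq_zero_iff hp hy).mp h2
  rw [ellTheta_eq_zero_iff hp (div_ne_zero hx hy)]
  by_cases h : p = 0
  · subst h
    have hk : k = 0 := by
      by_contra hk
      exact hx (zero_zpow k hk)
    have hl : l = 0 := by
      by_contra hk
      exact hy (zero_zpow l hk)
    exact ⟨0, by simp [hk, hl]⟩
  · exact ⟨k - l, (zpow_sub₀ h k l).symm⟩

lemma countable_ellTheta_zeros {p : ℂ} (hp : ‖p‖ < 1) :
    {x : ℂ | x ≠ 0 ∧ ellTheta p x = 0}.Countable := by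
  refine (Set.countable_range fun k : ℤ => p ^ k).mono ?_
  rintro x ⟨hx, h⟩
  obtain ⟨k, hk⟩ := (ellTheta_eq_zero_iff hp hx).mp h
  exact ⟨k, hk.symm⟩

end

/-! ### The Jacobi triple product, as a limit of the finite q-binomial theorem. -/

noncomputable section

open Filter Topology

/-- The finite product `∏_{1 ≤ j ≤ n} (1 - p ^ j)`. -/
def qFac (p : ℂ) (n : ℕ) : ℂ := ∏ j ∈ range n, (1 - p ^ (j + 1))

/-- The Gaussian binomial coefficient, as a quotient of `qFac`s. -/
def gaussBinom (p : ℂ) (n i : ℕ) : ℂ :=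
  if i ≤ n then qFac p n / (qFac p i * qFac p (n - i)) else 0

lemma qFac_succ (p : ℂ) (n : ℕ) : qFac p (n + 1) = qFac p n * (1 - p ^ (n + 1)) :=
  prod_range_succ _ _

lemma qFac_ne_zero {p : ℂ} (hp : ‖p‖ < 1) (n : ℕ) : qFac p n ≠ 0 := by
  refine prod_ne_zero_iff.mpr fun j _ h => ?_
  have h' : p ^ (j + 1) = 1 := by linear_combination -h
  have h1 := pow_lt_one₀ (norm_nonneg p) hp (Nat.succ_ne_zero j)
  rw [← norm_pow, Nat.succ_eq_add_one, h', norm_one] at h1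
  exact lt_irrefl _ h1

lemma tendsto_qFac {p : ℂ} (hp : ‖p‖ < 1) :
    Tendsto (qFac p) atTop (𝓝 (shiftedPochInf p 1)) := by
  have := (multipliable_one_sub_pow_succ_mul hp 1).hasProd.tendsto_prod_nat
  simpa [shiftedPochInf] using! this

lemma gaussBinom_zero {p : ℂ} (hp : ‖p‖ < 1) (n : ℕ) : gaussBinom p n 0 = 1 := by
  have := qFac_ne_zero hp n
  have h0 : qFac p 0 = 1 := rfl
  rw [gaussBinom, if_pos n.zero_le, h0, one_mul, Nat.sub_zero, div_self this]

/-- The q-Pascal rule; the default value 0 for i > n makes it valid at the boundary and beyond. -/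
lemma gaussBinom_succ {p : ℂ} (hp : ‖p‖ < 1) (n i : ℕ) :
    gaussBinom p (n + 1) (i + 1) = gaussBinom p n (i + 1) + p ^ (n - i) * gaussBinom p n i := by
  have h := qFac_ne_zero hp
  rcases lt_trichotomy i n with hi | rfl | hi
  · obtain ⟨d, rfl⟩ := Nat.exists_eq_add_of_lt hi
    have e1 : i + d + 1 + 1 - (i + 1) = d + 1 := by omega
    have e2 : i + d + 1 - (i + 1) = d := by omega
    have e3 : i + d + 1 - i = d + 1 := by omega
    rw [gaussBinom, gaussBinom, gaussBinom, if_pos (by omega), if_pos (by omega),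
      if_pos (by omega), e1, e2, e3, qFac_succ p (i + d + 1), qFac_succ p i, qFac_succ p d]
    have h1 := h (i + 1)
    have h2 := h (d + 1)
    rw [qFac_succ] at h1 h2
    have h1' := right_ne_zero_of_mul h1
    have h2' := right_ne_zero_of_mul h2
    have := h i
    have := h d
    field_simp
    ring
  · have := h i
    have := h (i + 1)
    simp [gaussBinom]
    simp [qFac]
    simp [qFac] at *
    field_simp
  · simp [gaussBinom, show ¬ i ≤ n by omega, show ¬ i + 1 ≤ n by omega]

/-- The finite `q`-binomial theorem. -/
lemma prod_one_sub_pow_mul {p : ℂ} (hp : ‖p‖ < 1) (t : ℂ) (n : ℕ) :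
    ∏ j ∈ range n, (1 - p ^ j * t) =
      ∑ i ∈ range (n + 1), (-1) ^ i * p ^ (i.choose 2) * gaussBinom p n i * t ^ i := by
  induction n with
  | zero => simp [gaussBinom_zero hp]
  | succ n ih =>
    have h0 : ∑ i ∈ range (n + 1), (-1) ^ i * p ^ (i.choose 2) * gaussBinom p n i * t ^ i =
        ∑ i ∈ range (n + 1), (-1) ^ (i + 1) * p ^ ((i + 1).choose 2) * gaussBinom p n (i + 1) *
          t ^ (i + 1) + 1 := by
      have hz : gaussBinom p n (n + 1) = 0 := by simp [gaussBinom]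
      have := sum_range_succ
        (fun i => (-1) ^ i * p ^ (i.choose 2) * gaussBinom p n i * t ^ i) (n + 1)
      rw [hz, mul_zero, zero_mul, add_zero] at this
      rw [← this, sum_range_succ']
      simp [gaussBinom_zero hp]
    rw [prod_range_succ, ih, sum_range_succ' _ (n + 1), mul_sub, mul_one]
    nth_rewrite 1 [h0]
    rw [sum_mul, add_sub_right_comm, ← sum_sub_distrib]
    congr 1
    · refine sum_congr rfl fun i hi => ?_
      rw [gaussBinom_succ hp, Nat.choose_succ_succ' i 1, Nat.choose_one_right]
      have : p ^ n = p ^ i * p ^ (n - i) := by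
        rw [← pow_add]; congr 1; have := mem_range.mp hi; omega
      rw [this]
      ring
    · simp [gaussBinom_zero hp]

/-- The triangular numbers `k (k - 1) / 2` for integer `k`. -/
def triangle (k : ℤ) : ℤ := k * (k - 1) / 2

lemma two_mul_triangle (k : ℤ) : 2 * triangle k = k * (k - 1) :=
  Int.mul_ediv_cancel' (Int.even_mul_pred_self k).two_dvd

lemma triangle_eq {k l : ℤ} (h : k * (k - 1) = 2 * l) : triangle k = l := by
  have := two_mul_triangle k
  omega

lemma triangle_natCast (i : ℕ) : triangle i = (i.choose 2 : ℕ) := by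
  apply triangle_eq
  rw [Nat.choose_two_right]
  have := (Nat.even_mul_pred_self i).two_dvd
  rcases i with _ | i
  · simp
  · push_cast [Nat.add_sub_cancel] at this ⊢
    have h2 : (2 : ℤ) ∣ ((i : ℤ) + 1) * i := by exact_mod_cast this
    rw [Int.mul_ediv_cancel' h2]
    ring

/-- The coefficient of `x ^ k` in the symmetric finite product is `(-1) ^ k p ^ (k (k - 1) / 2)`
times this number. -/
def tripleCoeff (p : ℂ) (n : ℕ) (k : ℤ) : ℂ :=
  if -(n : ℤ) ≤ k then gaussBinom p (2 * n) (n + k).toNat else 0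

/-- Shifting t = x p^(-n) centres the 2n factors: the upper n are those of x, and the lower n,
reflected, become those of 1/x times a monomial. -/
lemma prod_one_sub_pow_mul_split {p x : ℂ} (hp0 : p ≠ 0) (hx : x ≠ 0) (n : ℕ) :
    ∏ j ∈ range (2 * n), (1 - p ^ j * (x * p ^ (-(n : ℤ)))) =
      (-1) ^ n * x ^ n * p ^ (-triangle (n + 1)) *
        ∏ j ∈ range n, ((1 - p ^ j * x) * (1 - p ^ (j + 1) / x)) := by
  have key : ∏ j ∈ range n, (1 - p ^ j * (x * p ^ (-(n : ℤ)))) =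
      (-1) ^ n * x ^ n * p ^ (-triangle (n + 1)) * ∏ j ∈ range n, (1 - p ^ (j + 1) / x) := by
    rw [← prod_range_reflect]
    have h1 : p ^ (-triangle (n + 1)) = ∏ j ∈ range n, p ^ (-((j : ℤ) + 1)) := by
      induction n with
      | zero => simp [triangle]
      | succ n ih =>
        rw [prod_range_succ, ← ih, ← zpow_add₀ hp0]
        congr 1
        have := two_mul_triangle (n + 1)
        have h := two_mul_triangle ((n + 1 : ℕ) + 1)
        push_cast at *
        linarith
    rw [h1]
    have h2 : (-1 : ℂ) ^ n * x ^ n = ∏ j ∈ range n, (-x) := by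
      rw [prod_const, card_range, neg_pow x]
    rw [h2, ← prod_mul_distrib, ← prod_mul_distrib]
    refine prod_congr rfl fun j hj => ?_
    have hj' := mem_range.mp hj
    have e : p ^ (n - 1 - j) * p ^ (-(n : ℤ)) = p ^ (-((j : ℤ) + 1)) := by
      rw [← zpow_natCast, ← zpow_add₀ hp0]
      congr 1
      omega
    have e2 : p ^ (-((j : ℤ) + 1)) * p ^ (j + 1) = 1 := by
      rw [← zpow_natCast, ← zpow_add₀ hp0]
      simp
    have : x * p ^ (j + 1) / x = p ^ (j + 1) := by field_simp
    calc 1 - p ^ (n - 1 - j) * (x * p ^ (-(n : ℤ)))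
        = 1 - x * (p ^ (n - 1 - j) * p ^ (-(n : ℤ))) := by ring
      _ = p ^ (-((j : ℤ) + 1)) * p ^ (j + 1) - x * p ^ (-((j : ℤ) + 1)) := by rw [e, e2]
      _ = p ^ (-((j : ℤ) + 1)) * (x * p ^ (j + 1) / x) - x * p ^ (-((j : ℤ) + 1)) := by
        rw [this]
      _ = _ := by ring
  rw [two_mul, prod_range_add, key, prod_mul_distrib]
  have : ∏ j ∈ range n, (1 - p ^ (n + j) * (x * p ^ (-(n : ℤ)))) =
      ∏ j ∈ range n, (1 - p ^ j * x) := by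
    refine prod_congr rfl fun j _ => ?_
    rw [pow_add, zpow_neg, zpow_natCast]
    field_simp
  rw [this]
  ring

lemma prod_eq_tsum_tripleCoeff {p x : ℂ} (hp : ‖p‖ < 1) (hp0 : p ≠ 0) (hx : x ≠ 0) (n : ℕ) :
    ∏ j ∈ range n, ((1 - p ^ j * x) * (1 - p ^ (j + 1) / x)) =
      ∑' k : ℤ, (-1) ^ k * p ^ triangle k * x ^ k * tripleCoeff p n k := by
  let e : ℕ ↪ ℤ := ⟨fun i => (i : ℤ) - n, fun i j h => by simpa using h⟩
  rw [tsum_eq_sum (s := (range (2 * n + 1)).map e), sum_map]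
  · have h := prod_one_sub_pow_mul_split hp0 hx n
    rw [prod_one_sub_pow_mul hp] at h
    have hc : (-1) ^ n * x ^ n * p ^ (-triangle (n + 1)) ≠ 0 :=
      mul_ne_zero (mul_ne_zero (pow_ne_zero _ (by norm_num)) (pow_ne_zero _ hx))
        (zpow_ne_zero _ hp0)
    apply mul_left_cancel₀ hc
    rw [← h, mul_sum]
    refine sum_congr rfl fun i hi => ?_
    have e1 : e i = (i : ℤ) - n := rfl
    have e2 : tripleCoeff p n (e i) = gaussBinom p (2 * n) i := by
      rw [tripleCoeff, if_pos (by omega)]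
      congr 1
      omega
    have e3 : (-1 : ℂ) ^ n * (-1) ^ ((i : ℤ) - n) = (-1) ^ i := by
      rw [← zpow_natCast, ← zpow_add₀ (by norm_num), ← zpow_natCast]; congr 1; ring
    have e4 : x ^ n * x ^ ((i : ℤ) - n) = x ^ i := by
      rw [← zpow_natCast, ← zpow_add₀ hx, ← zpow_natCast]; congr 1; ring
    have e5 : p ^ (-triangle (n + 1)) * p ^ triangle ((i : ℤ) - n) =
        p ^ (i.choose 2) * (p ^ (-(n : ℤ))) ^ i := by
      rw [← zpow_add₀ hp0, ← zpow_natCast p, ← zpow_natCast (p ^ _), ← zpow_mul, ← zpow_add₀ hp0,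
        ← triangle_natCast]
      congr 1
      have h1 := two_mul_triangle (n + 1)
      have h2 := two_mul_triangle ((i : ℤ) - n)
      have h3 := two_mul_triangle i
      linarith
    rw [e2, e1, mul_pow, ← e3, ← e4]
    linear_combination -((-1) ^ n * (-1) ^ ((i : ℤ) - n) * (x ^ n * x ^ ((i : ℤ) - n)) *
      gaussBinom p (2 * n) i) * e5
  · intro k hk
    have : tripleCoeff p n k = 0 := by
      rw [tripleCoeff]
      split_ifs with h
      · rw [gaussBinom, if_neg]
        intro h'
        apply hk
        rw [Finset.mem_map]
        refine ⟨(n + k).toNat, mem_range.mpr (by omega), ?_⟩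
        change (((n + k).toNat : ℕ) : ℤ) - n = k
        omega
      · rfl
    rw [this, mul_zero]

/-- Both n + k and n - k tend to infinity, so two of the three limits Q in Q/(Q·Q) survive in the
denominator against one above. -/
lemma tendsto_tripleCoeff {p : ℂ} (hp : ‖p‖ < 1) (k : ℤ) :
    Tendsto (fun n => tripleCoeff p n k) atTop (𝓝 (shiftedPochInf p 1)⁻¹) := by
  have hQ := tendsto_qFac hp
  have h0 := shiftedPochInf_one_ne_zero hp
  have t1 : Tendsto (fun n : ℕ => 2 * n) atTop atTop :=
    tendsto_atTop_mono (fun n => show n ≤ 2 * n by omega) tendsto_id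
  have t2 : Tendsto (fun n : ℕ => ((n : ℤ) + k).toNat) atTop atTop := by
    refine tendsto_atTop.mpr fun b => ?_
    filter_upwards [eventually_ge_atTop (b + k.natAbs)] with n hn
    omega
  have t3 : Tendsto (fun n : ℕ => ((n : ℤ) - k).toNat) atTop atTop := by
    refine tendsto_atTop.mpr fun b => ?_
    filter_upwards [eventually_ge_atTop (b + k.natAbs)] with n hn
    omega
  have := (hQ.comp t1).div ((hQ.comp t2).mul (hQ.comp t3)) (mul_ne_zero h0 h0)
  rw [div_mul_cancel_left₀ h0] at this
  refine this.congr' ?_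
  filter_upwards [eventually_ge_atTop k.natAbs] with n hn
  rw [tripleCoeff, if_pos (by omega), gaussBinom, if_pos (by omega)]
  have : 2 * n - ((n : ℤ) + k).toNat = ((n : ℤ) - k).toNat := by omega
  rw [this]
  rfl

/-- Uniformity in n and k supplies the dominating series when the limit passes through the bilateral
sum. -/
lemma exists_norm_tripleCoeff_le {p : ℂ} (hp : ‖p‖ < 1) :
    ∃ C : ℝ, ∀ n k, ‖tripleCoeff p n k‖ ≤ C := by
  have hQ := tendsto_qFac hp
  have h0 := shiftedPochInf_one_ne_zero hp
  obtain ⟨A, hA⟩ := (Metric.isBounded_range_of_tendsto _ hQ).exists_norm_le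
  obtain ⟨B, hB⟩ := (Metric.isBounded_range_of_tendsto _ (hQ.inv₀ h0)).exists_norm_le
  have hA' : ∀ n, ‖qFac p n‖ ≤ A := fun n => hA _ ⟨n, rfl⟩
  have hB' : ∀ n, ‖(qFac p n)⁻¹‖ ≤ B := fun n => hB _ ⟨n, rfl⟩
  have hA0 : 0 ≤ A := (norm_nonneg _).trans (hA' 0)
  have hB0 : 0 ≤ B := (norm_nonneg _).trans (hB' 0)
  refine ⟨A * (B * B), fun n k => ?_⟩
  rw [tripleCoeff]
  split_ifs with h
  · rw [gaussBinom]
    split_ifs with h'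
    · rw [div_eq_mul_inv, mul_inv, norm_mul, norm_mul]
      gcongr
      exacts [hA' _, hB' _, hB' _]
    · rw [norm_zero]; positivity
  · rw [norm_zero]; positivity

lemma summable_nat_of_ratio {f : ℕ → ℝ} {r c : ℝ} (hf : ∀ n, 0 < f n) (hr0 : 0 ≤ r) (hr : r < 1)
    (h : ∀ n, f (n + 1) = f n * (r ^ n * c)) : Summable f := by
  refine summable_of_ratio_test_tendsto_lt_one (l := 0) one_pos
    (.of_forall fun n => (hf n).ne') ?_
  have : (fun n => ‖f (n + 1)‖ / ‖f n‖) = fun n => r ^ n * ‖c‖ := by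
    funext n
    have := (hf n).ne'
    rw [h, norm_mul, norm_mul, Real.norm_of_nonneg (pow_nonneg hr0 n)]
    field_simp
  rw [this]
  simpa using (tendsto_pow_atTop_nhds_zero_of_lt_one hr0 hr).mul_const ‖c‖

lemma summable_norm_theta_term {p x : ℂ} (hp : ‖p‖ < 1) (hp0 : p ≠ 0) (hx : x ≠ 0) :
    Summable fun k : ℤ => ‖(-1) ^ k * p ^ triangle k * x ^ k‖ := by
  have hp' : 0 < ‖p‖ := norm_pos_iff.mpr hp0
  have hx' : 0 < ‖x‖ := norm_pos_iff.mpr hx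
  simp only [norm_mul, norm_zpow, norm_neg, norm_one, one_zpow, one_mul]
  apply Summable.of_nat_of_neg
  · refine summable_nat_of_ratio (c := ‖x‖) (fun n => by positivity) hp'.le hp fun n => ?_
    have : triangle ((n + 1 : ℕ) : ℤ) = triangle n + n := by
      have h1 := two_mul_triangle n
      have h2 := two_mul_triangle ((n + 1 : ℕ) : ℤ)
      push_cast at *
      linarith
    rw [this, zpow_add₀ hp'.ne', Nat.cast_succ, zpow_add_one₀ hx'.ne', zpow_natCast _ n]
    ring
  · refine summable_nat_of_ratio (c := ‖p‖ / ‖x‖) (fun n => by positivity) hp'.le hp fun n => ?_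
    have : triangle (-((n + 1 : ℕ) : ℤ)) = triangle (-n) + (n + 1 : ℕ) := by
      have h1 := two_mul_triangle (-n)
      have h2 := two_mul_triangle (-((n + 1 : ℕ) : ℤ))
      push_cast at *
      linarith
    have h3 : -((n + 1 : ℕ) : ℤ) = -(n : ℤ) - 1 := by push_cast; ring
    rw [this, zpow_add₀ hp'.ne', h3, zpow_sub_one₀ hx'.ne', zpow_natCast, pow_succ]
    ring

/-- The **Jacobi triple product identity**. -/
theorem ellTheta_eq_tsum {p x : ℂ} (hp : ‖p‖ < 1) (hp0 : p ≠ 0) (hx : x ≠ 0) :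
    shiftedPochInf p 1 * ellTheta p x = ∑' k : ℤ, (-1) ^ k * p ^ triangle k * x ^ k := by
  obtain ⟨C, hC⟩ := exists_norm_tripleCoeff_le hp
  have h1 := (ellTheta_multipliable hp x).hasProd.tendsto_prod_nat
  have h2 : Tendsto (fun n => ∑' k : ℤ, (-1) ^ k * p ^ triangle k * x ^ k * tripleCoeff p n k)
      atTop (𝓝 (∑' k : ℤ, (-1) ^ k * p ^ triangle k * x ^ k * (shiftedPochInf p 1)⁻¹)) := by
    refine tendsto_tsum_of_dominated_convergence
      ((summable_norm_theta_term hp hp0 hx).mul_right C)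
      (fun k => (tendsto_tripleCoeff hp k).const_mul _) (.of_forall fun n k => ?_)
    rw [norm_mul]
    exact mul_le_mul_of_nonneg_left (hC n k) (norm_nonneg _)
  have h3 := tendsto_nhds_unique (h1.congr fun n => prod_eq_tsum_tripleCoeff hp hp0 hx n) h2
  rw [ellTheta, h3, tsum_mul_right]
  field_simp [shiftedPochInf_one_ne_zero hp]

end

/-! ### The addition formula and elliptic partial fractions. -/

noncomputable section

/-- Pairs of integers, split according to the parity of the sum of the entries: even sums are
`(i + j, i - j)` and odd sums are `(i + j + 1, i - j)`. -/
def intPairParityEquiv : (ℤ × ℤ) ⊕ (ℤ × ℤ) ≃ ℤ × ℤ :=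
  Equiv.ofBijective
    (Sum.elim (fun v => (v.1 + v.2, v.1 - v.2)) fun v => (v.1 + v.2 + 1, v.1 - v.2)) <| by
    constructor
    · rintro (⟨a, b⟩ | ⟨a, b⟩) (⟨c, d⟩ | ⟨c, d⟩) h <;>
        simp only [Sum.elim_inl, Sum.elim_inr, Prod.mk.injEq, Sum.inl.injEq, Sum.inr.injEq,
          reduceCtorEq] at h ⊢ <;> omega
    · rintro ⟨a, b⟩
      rcases Int.even_or_odd' (a + b) with ⟨c, hc | hc⟩
      · exact ⟨Sum.inl (c, a - c), by
          simp only [Sum.elim_inl, Prod.mk.injEq]; omega⟩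
      · exact ⟨Sum.inr (c, a - c - 1), by
          simp only [Sum.elim_inr, Prod.mk.injEq]; omega⟩

/-- Restricting the double series to the two axes gives summability of each factor; this is why one
nonzero entry of each is needed. -/
lemma tsum_mul_of_summable_prod {a b : ℤ → ℂ} (hab : Summable fun v : ℤ × ℤ => a v.1 * b v.2)
    (ha : a 0 ≠ 0) (hb : b 0 ≠ 0) :
    ∑' v : ℤ × ℤ, a v.1 * b v.2 = (∑' i, a i) * ∑' j, b j := by
  have h1 : Summable a := by
    have := hab.comp_injective (i := fun i : ℤ => (i, (0 : ℤ))) fun i j h => by simpa using h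
    exact (summable_mul_right_iff hb).mp this
  have h2 : Summable b := by
    have := hab.comp_injective (i := fun i : ℤ => ((0 : ℤ), i)) fun i j h => by simpa using h
    exact (summable_mul_left_iff ha).mp this
  exact (h1.tsum_mul_tsum h2 hab).symm

/-- The product `θ(x y) θ(x / y)` is a form of rank two in `(x, y)`. -/
lemma exists_ellTheta_mul_eq {p : ℂ} (hp : ‖p‖ < 1) : ∃ A₀ B₀ A₁ B₁ : ℂ → ℂ, ∀ x y : ℂ,
    x ≠ 0 → y ≠ 0 →
      ellTheta p (x * y) * ellTheta p (x / y) = A₀ x * B₀ y + A₁ x * B₁ y := by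
  rcases eq_or_ne p 0 with rfl | hp0
  · have h (x : ℂ) : ellTheta 0 x = 1 - x := by
      rw [ellTheta_eq hp]
      simp [shiftedPochInf]
    refine ⟨fun x => 1 + x ^ 2, fun _ => 1, fun x => -x, fun y => y + 1 / y, fun x y hx hy => ?_⟩
    rw [h, h]
    field_simp
    ring
  have hQ := shiftedPochInf_one_ne_zero hp
  set Q := shiftedPochInf p 1
  -- The product of the two theta series has terms x^(m+n) y^(m-n). Sorting by the parity of m + n,
  -- via (m, n) = (i + j, i - j) or (i + j + 1, i - j), makes each half factor into an x-series
  -- times a y-series; the odd half carries the minus sign.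
  refine ⟨fun x => Q⁻¹ ^ 2 * ∑' i : ℤ, p ^ (i * i - i) * x ^ (2 * i),
    fun y => ∑' j : ℤ, p ^ (j * j) * y ^ (2 * j),
    fun x => -Q⁻¹ ^ 2 * ∑' i : ℤ, p ^ (i * i) * x ^ (2 * i + 1),
    fun y => ∑' j : ℤ, p ^ (j * j + j) * y ^ (2 * j + 1), fun x y hx hy => ?_⟩
  let t (x : ℂ) (k : ℤ) : ℂ := (-1) ^ k * p ^ triangle k * x ^ k
  have s1 := summable_norm_theta_term hp hp0 (mul_ne_zero hx hy)
  have s2 := summable_norm_theta_term hp hp0 (div_ne_zero hx hy)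
  have hs : Summable fun v : ℤ × ℤ => t (x * y) v.1 * t (x / y) v.2 :=
    summable_mul_of_summable_norm s1 s2
  have hmain : (Q * ellTheta p (x * y)) * (Q * ellTheta p (x / y)) =
      ∑' v : ℤ × ℤ, t (x * y) v.1 * t (x / y) v.2 := by
    rw [ellTheta_eq_tsum hp hp0 (mul_ne_zero hx hy), ellTheta_eq_tsum hp hp0 (div_ne_zero hx hy)]
    exact tsum_mul_tsum_of_summable_norm s1 s2
  have hterm (m n : ℤ) : t (x * y) m * t (x / y) n =
      (-1) ^ (m + n) * p ^ (triangle m + triangle n) * x ^ (m + n) * y ^ (m - n) := by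
    simp only [t]
    rw [mul_zpow, div_zpow, zpow_add₀ (by norm_num), zpow_add₀ hp0, zpow_add₀ hx, zpow_sub₀ hy]
    ring
  have heven (v : ℤ × ℤ) : t (x * y) (v.1 + v.2) * t (x / y) (v.1 - v.2) =
      (p ^ (v.1 * v.1 - v.1) * x ^ (2 * v.1)) * (p ^ (v.2 * v.2) * y ^ (2 * v.2)) := by
    have e1 : v.1 + v.2 + (v.1 - v.2) = 2 * v.1 := by ring
    have e2 : v.1 + v.2 - (v.1 - v.2) = 2 * v.2 := by ring
    have e3 : triangle (v.1 + v.2) + triangle (v.1 - v.2) = v.1 * v.1 - v.1 + v.2 * v.2 := by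
      have h1 := two_mul_triangle (v.1 + v.2)
      have h2 := two_mul_triangle (v.1 - v.2)
      linarith
    rw [hterm, e1, e2, e3, zpow_add₀ hp0, (even_two_mul v.1).neg_one_zpow]
    ring
  have hodd (v : ℤ × ℤ) : t (x * y) (v.1 + v.2 + 1) * t (x / y) (v.1 - v.2) =
      -((p ^ (v.1 * v.1) * x ^ (2 * v.1 + 1)) *
        (p ^ (v.2 * v.2 + v.2) * y ^ (2 * v.2 + 1))) := by
    have e1 : v.1 + v.2 + 1 + (v.1 - v.2) = 2 * v.1 + 1 := by ring
    have e2 : v.1 + v.2 + 1 - (v.1 - v.2) = 2 * v.2 + 1 := by ring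
    have e3 : triangle (v.1 + v.2 + 1) + triangle (v.1 - v.2) =
        v.1 * v.1 + (v.2 * v.2 + v.2) := by
      have h1 := two_mul_triangle (v.1 + v.2 + 1)
      have h2 := two_mul_triangle (v.1 - v.2)
      linarith
    rw [hterm, e1, e2, e3, zpow_add₀ hp0, (odd_two_mul_add_one v.1).neg_one_zpow]
    ring
  have hs' := intPairParityEquiv.summable_iff.mpr hs
  have hs0 := hs'.comp_injective Sum.inl_injective
  have hs1 := hs'.comp_injective Sum.inr_injective
  have hsplit : ∑' v : ℤ × ℤ, t (x * y) v.1 * t (x / y) v.2 =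
      (∑' v : ℤ × ℤ, t (x * y) (v.1 + v.2) * t (x / y) (v.1 - v.2)) +
        ∑' v : ℤ × ℤ, t (x * y) (v.1 + v.2 + 1) * t (x / y) (v.1 - v.2) := by
    rw [← intPairParityEquiv.tsum_eq]
    exact hs0.tsum_sum hs1
  have hs0' := hs0.congr heven
  have hs1' := (hs1.congr hodd).neg
  simp only [neg_neg] at hs1'
  rw [hsplit, tsum_congr heven, tsum_congr hodd, tsum_neg,
    tsum_mul_of_summable_prod (a := fun i => p ^ (i * i - i) * x ^ (2 * i))
      (b := fun j => p ^ (j * j) * y ^ (2 * j)) hs0' (by simp) (by simp),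
    tsum_mul_of_summable_prod (a := fun i => p ^ (i * i) * x ^ (2 * i + 1))
      (b := fun j => p ^ (j * j + j) * y ^ (2 * j + 1)) hs1' (by simpa) (by simpa)] at hmain
  have hdiv : ellTheta p (x * y) * ellTheta p (x / y) =
      Q⁻¹ ^ 2 * ((Q * ellTheta p (x * y)) * (Q * ellTheta p (x / y))) := by
    field_simp
  rw [hdiv, hmain]
  ring

/-- An alternating form of rank at most two satisfies the Plücker relation. -/
lemma plucker_of_alternating {ι : Type*} (a b c d : ι → ℂ)
    (h : ∀ i j, a i * b j + c i * d j = -(a j * b i + c j * d i)) (i j k l : ι) :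
    (a i * b j + c i * d j) * (a k * b l + c k * d l) -
        (a i * b k + c i * d k) * (a j * b l + c j * d l) +
      (a i * b l + c i * d l) * (a j * b k + c j * d k) = 0 := by
  obtain ⟨g, hg⟩ : ∃ g : ι → ι → ℂ, ∀ i j, a i * b j + c i * d j = g i j := ⟨_, fun _ _ => rfl⟩
  have hanti (i j) : g j i = -g i j := by rw [← hg, ← hg, h]
  have hself (i) : g i i = 0 := self_eq_neg.mp (hanti i i)
  have key (i j k l) : g i j * (g i j * g k l - g i k * g j l + g i l * g j k) = 0 := by
    -- The 3 × 3 minor with rows i, j, k and columns i, j, l vanishes by rank two; antisymmetry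
    -- reduces it to g i j times the Pfaffian.
    have hdet : g i i * (g j j * g k l - g j l * g k j) - g i j * (g j i * g k l - g j l * g k i) +
        g i l * (g j i * g k j - g j j * g k i) = 0 := by
      simp only [← hg]
      ring
    rw [hself, hself, hanti i j, hanti i k, hanti j k] at hdet
    linear_combination hdet
  simp only [hg]
  have h1 := key i j k l
  have h2 := key i k j l
  have h3 := key i l j k
  rw [hanti j k] at h2
  rw [hanti k l, hanti j l] at h3
  -- Every term of the Pfaffian has a factor that annihilates the Pfaffian, so its square is zero;
  -- no case split on vanishing entries is needed.
  rw [← pow_eq_zero_iff two_ne_zero]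
  linear_combination g k l * h1 + g j l * h2 + g j k * h3

/-- The three-term (Weierstrass) addition formula. -/
theorem ellTheta_addition {p : ℂ} (hp : ‖p‖ < 1) {x y u v : ℂ} (hx : x ≠ 0) (hy : y ≠ 0)
    (hu : u ≠ 0) (hv : v ≠ 0) :
    ellTheta p (x * y) * ellTheta p (x / y) * (ellTheta p (u * v) * ellTheta p (u / v)) =
      u / y * (ellTheta p (x * u) * ellTheta p (x / u) * (ellTheta p (y * v) * ellTheta p (y / v)) -
        ellTheta p (x * v) * ellTheta p (x / v) * (ellTheta p (y * u) * ellTheta p (y / u))) := by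
  obtain ⟨A, B, C, D, h⟩ := exists_ellTheta_mul_eq hp
  -- Division by x turns θ(xy)θ(x/y) into an alternating form.
  have key := plucker_of_alternating (ι := {x : ℂ // x ≠ 0}) (fun x => A x / x) (fun x => B x)
    (fun x => C x / x) (fun x => D x) (fun ⟨x, hx⟩ ⟨y, hy⟩ => by
      have e1 := h x y hx hy
      have e2 := h y x hy hx
      rw [ellTheta_div_comm hp hx hy, mul_comm y x] at e2
      field_simp at e2 ⊢
      linear_combination (-y) * e1 - e2) ⟨x, hx⟩ ⟨y, hy⟩ ⟨u, hu⟩ ⟨v, hv⟩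
  rw [h x y hx hy, h u v hu hv, h x u hx hu, h y v hy hv, h x v hx hv, h y u hy hu]
  simp only at key
  field_simp at key ⊢
  linear_combination key

/-- Every function `θ(x / c) θ(x / d)` is a combination of two such functions with the same product
of parameters. -/
lemma exists_ellTheta_combination {p : ℂ} (hp : ‖p‖ < 1) {c d a b : ℂ} (hc : c ≠ 0) (hd : d ≠ 0)
    (ha : a ≠ 0) (hb : b ≠ 0) (hab : ellTheta p (a / b) ≠ 0)
    (habc : ellTheta p (a * b * (c * d)) ≠ 0) :
    ∃ α β : ℂ, ∀ x, x ≠ 0 → ellTheta p (x * c) * ellTheta p (x * d) =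
      α * (ellTheta p (x / a) * ellTheta p (x * (a * c * d))) +
        β * (ellTheta p (x / b) * ellTheta p (x * (b * c * d))) := by
  -- A square root e of cd centres the pair: with X = ex and Y = c/e one has XY = xc and X/Y = xd,
  -- which is the shape of the addition formula.
  obtain ⟨e, he'⟩ := IsAlgClosed.exists_pow_nat_eq (c * d) two_pos
  have he := he'.symm
  have he0 : e ≠ 0 := by
    rintro rfl
    exact mul_ne_zero hc hd (by simpa using he)
  have key (x : ℂ) (hx : x ≠ 0) := ellTheta_addition hp (x := e * x) (y := c / e) (u := e * a)
    (v := e * b) (mul_ne_zero he0 hx) (div_ne_zero hc he0) (mul_ne_zero he0 ha)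
    (mul_ne_zero he0 hb)
  have huv : e * a * (e * b) = a * b * (c * d) := by rw [he]; ring
  have huv' : e * a / (e * b) = a / b := mul_div_mul_left _ _ he0
  rw [huv, huv'] at key
  refine ⟨e * a / (c / e) * (ellTheta p (c / e * (e * b)) * ellTheta p (c / e / (e * b))) /
      (ellTheta p (a * b * (c * d)) * ellTheta p (a / b)),
    -(e * a / (c / e)) * (ellTheta p (c / e * (e * a)) * ellTheta p (c / e / (e * a))) /
      (ellTheta p (a * b * (c * d)) * ellTheta p (a / b)), fun x hx => ?_⟩
  have hk := key x hx
  have e1 : e * x * (c / e) = x * c := by field_simp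
  have e2 : e * x / (c / e) = x * d := by field_simp; rw [he]
  have e3 : e * x * (e * a) = x * (a * c * d) := by linear_combination (-x * a) * he
  have e4 : e * x / (e * a) = x / a := mul_div_mul_left _ _ he0
  have e5 : e * x * (e * b) = x * (b * c * d) := by linear_combination (-x * b) * he
  have e6 : e * x / (e * b) = x / b := mul_div_mul_left _ _ he0
  rw [e1, e2, e3, e4, e5, e6] at hk
  rw [eq_div_of_mul_eq (mul_ne_zero habc hab) hk]
  ring

/-- A zero of the numerator at one of the nodes removes that node. -/
lemma sum_ellTheta_div_erase {ι : Type*} [DecidableEq ι] {p : ℂ} (s : Finset ι) (x F : ι → ℂ)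
    (hx : ∀ i ∈ s, x i ≠ 0)
    (hd : ∀ i ∈ s, ∀ j ∈ s, i ≠ j → ellTheta p (x i / x j) ≠ 0) {i : ι} (hi : i ∈ s) :
    ∑ k ∈ s, ellTheta p (x k / x i) * F k / ∏ j ∈ s.erase k, ellTheta p (x k / x j) =
      ∑ k ∈ s.erase i, F k / ∏ j ∈ (s.erase i).erase k, ellTheta p (x k / x j) := by
  rw [← add_sum_erase s _ hi, div_self (hx i hi), ellTheta_one, zero_mul, zero_div, zero_add]
  refine sum_congr rfl fun k hk => ?_
  have hki := (mem_erase.mp hk).1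
  rw [erase_right_comm, ← mul_prod_erase (s.erase k) (fun j => ellTheta p (x k / x j))
    (mem_erase.mpr ⟨hki.symm, hi⟩)]
  exact mul_div_mul_left _ _ (hd k (mem_erase.mp hk).2 i hi hki)

/-- The elliptic partial fraction identity. -/
theorem sum_prod_ellTheta_div_eq_zero {ι : Type*} [DecidableEq ι] {p : ℂ} (hp : ‖p‖ < 1)
    (s : Finset ι) (x : ι → ℂ) (c : Multiset ℂ) (hcard : c.card = s.card)
    (hx : ∀ i ∈ s, x i ≠ 0) (hc : ∀ a ∈ c, a ≠ 0)
    (hd : ∀ i ∈ s, ∀ j ∈ s, i ≠ j → ellTheta p (x i / x j) ≠ 0)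
    (hbal : (∏ i ∈ s, x i) * c.prod = 1) :
    ∑ k ∈ s, (c.map fun a => ellTheta p (x k * a)).prod /
      ∏ j ∈ s.erase k, ellTheta p (x k / x j) = 0 := by
  induction hn : s.card using Nat.strong_induction_on generalizing s c with
  | _ n ih =>
  subst hn
  -- The reduction below needs three nodes, so the smaller cases are checked directly.
  rcases lt_or_ge s.card 3 with h3 | h3
  · obtain h | h | h : s.card = 0 ∨ s.card = 1 ∨ s.card = 2 := by omega
    · rw [card_eq_zero.mp h, sum_empty]
    · obtain ⟨i, rfl⟩ := card_eq_one.mp h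
      obtain ⟨a, rfl⟩ := Multiset.card_eq_one.mp (hcard.trans h)
      rw [prod_singleton, Multiset.prod_singleton] at hbal
      simp [hbal, ellTheta_one]
    · obtain ⟨i, j, hij, rfl⟩ := card_eq_two.mp h
      obtain ⟨a, b, rfl⟩ := Multiset.card_eq_two.mp (hcard.trans h)
      rw [prod_pair hij] at hbal
      have hi := hx i (by simp)
      have hj := hx j (by simp)
      have ha := hc a (by simp)
      have hb := hc b (by simp)
      have hbal' : x i * x j * (a * b) = 1 := by simpa using hbal
      have hne := hd i (by simp) j (by simp) hij
      have e1 : x j * b = (x i * a)⁻¹ := eq_inv_of_mul_eq_one_left (by linear_combination hbal')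
      have e2 : x j * a = (x i * b)⁻¹ := eq_inv_of_mul_eq_one_left (by linear_combination hbal')
      have e3 : ({i, j} : Finset ι).erase i = {j} := by
        ext k; simp only [mem_erase, mem_insert, mem_singleton]; grind
      have e4 : ({i, j} : Finset ι).erase j = {i} := by
        ext k; simp only [mem_erase, mem_insert, mem_singleton]; grind
      rw [sum_pair hij, e3, e4, prod_singleton, prod_singleton]
      simp only [Multiset.insert_eq_cons, Multiset.map_cons, Multiset.map_singleton,
        Multiset.prod_cons, Multiset.prod_singleton]
      rw [e1, e2, ellTheta_inv hp (mul_ne_zero hi ha), ellTheta_inv hp (mul_ne_zero hi hb),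
        ellTheta_div_comm hp hi hj]
      field_simp
      linear_combination (ellTheta p (x i * a) * ellTheta p (x i * b)) * hbal'
  · obtain ⟨a, ha'⟩ := Multiset.card_pos_iff_exists_mem.mp (show 0 < c.card by omega)
    obtain ⟨c, rfl⟩ := Multiset.exists_cons_of_mem ha'
    rw [Multiset.card_cons] at hcard
    obtain ⟨b, hb'⟩ := Multiset.card_pos_iff_exists_mem.mp (show 0 < c.card by omega)
    obtain ⟨c, rfl⟩ := Multiset.exists_cons_of_mem hb'
    rw [Multiset.card_cons] at hcard
    have ha := hc a (by simp)
    have hb := hc b (by simp)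
    -- If θ(x_i x_j ab) and θ(x_i x_k ab) both vanished, so would θ(x_j/x_k).
    obtain ⟨i, j, hi, hj, hij, hne⟩ : ∃ i j, i ∈ s ∧ j ∈ s ∧ i ≠ j ∧
        ellTheta p (x i * x j * (a * b)) ≠ 0 := by
      obtain ⟨i, hi, j, hj, k, hk, hij, hik, hjk⟩ := two_lt_card.mp h3
      by_contra! hall
      have h1 := hall i j hi hj hij
      have h2 := hall i k hi hk hik
      refine hd j hj k hk hjk ?_
      have := ellTheta_div_eq_zero hp
        (mul_ne_zero (mul_ne_zero (hx i hi) (hx j hj)) (mul_ne_zero ha hb))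
        (mul_ne_zero (mul_ne_zero (hx i hi) (hx k hk)) (mul_ne_zero ha hb)) h1 h2
      rwa [mul_div_mul_right _ _ (mul_ne_zero ha hb), mul_div_mul_left _ _ (hx i hi)] at this
    obtain ⟨α, β, hαβ⟩ := exists_ellTheta_combination hp ha hb (hx i hi) (hx j hj)
      (hd i hi j hj hij) hne
    -- In each part of the combination the factor θ(x_k/x_i) cancels node i, while a and b merge
    -- into x_i a b. The balance persists with one node fewer.
    have hsub (i : ι) (hi : i ∈ s) :
        ∑ k ∈ s, ellTheta p (x k / x i) *
            (((x i * a * b) ::ₘ c).map fun a => ellTheta p (x k * a)).prod /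
          ∏ j ∈ s.erase k, ellTheta p (x k / x j) = 0 := by
      rw [sum_ellTheta_div_erase s x _ hx hd hi]
      have hcs := card_erase_of_mem hi
      refine ih (s.erase i).card (by omega) (s.erase i) _ ?_
        (fun k hk => hx k (mem_erase.mp hk).2) ?_
        (fun k hk l hl => hd k (mem_erase.mp hk).2 l (mem_erase.mp hl).2) ?_ rfl
      · rw [Multiset.card_cons]
        omega
      · intro e he
        rcases Multiset.mem_cons.mp he with rfl | he
        · exact mul_ne_zero (mul_ne_zero (hx i hi) ha) hb
        · exact hc e (by simp [he])
      · rw [← mul_prod_erase s x hi] at hbal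
        simp only [Multiset.prod_cons] at hbal ⊢
        linear_combination hbal
    have := congrArg₂ (fun u v => α * u + β * v) (hsub i hi) (hsub j hj)
    simp only [mul_zero, add_zero, mul_sum, ← sum_add_distrib] at this
    rw [← this]
    refine sum_congr rfl fun k hk => ?_
    simp only [Multiset.map_cons, Multiset.prod_cons]
    rw [← mul_assoc, hαβ (x k) (hx k hk)]
    ring

end

/-! ### Weyl denominators, Pochhammer symbols, and the dual form of partial fractions. -/

noncomputable section

/-- Puts a product over j ≠ k into the ordered-pair form of `ellDelta`, so that the two can be
compared factor by factor. -/
lemma prod_erase_univ_eq_prod_Ioi {n : ℕ} (k : Fin n) (u : Fin n → ℂ) :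
    ∏ j ∈ univ.erase k, u j =
      ∏ j, ∏ l ∈ Ioi j, if l = k then u j else if j = k then u l else 1 := by
  rw [← mul_prod_erase univ _ (mem_univ k), ← prod_filter_not_mul_prod_filter _ (· < k)]
  congr 1
  · have : (univ.erase k).filter (fun j => ¬ j < k) = Ioi k := by
      ext j
      simp only [mem_filter, mem_erase, mem_univ, and_true, mem_Ioi]
      grind
    rw [this]
    refine prod_congr rfl fun l hl => ?_
    rw [if_neg (mem_Ioi.mp hl).ne', if_pos rfl]
  · rw [prod_filter]
    refine prod_congr rfl fun j hj => ?_
    have hjk := (mem_erase.mp hj).1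
    simp only [if_neg hjk, prod_ite_eq', mem_Ioi]

/-- Only pairs containing k change. When k is the smaller index, theta inversion is needed, and the
prefactor z_j of the Weyl denominator absorbs the resulting monomial. -/
lemma ellDelta_update {p q : ℂ} (hp : ‖p‖ < 1) (hq : q ≠ 0) {n : ℕ} {z : Fin n → ℂ}
    (hz : ∀ k, z k ≠ 0) (k : Fin n) :
    ellDelta p (Function.update z k (q * z k)) * ∏ j ∈ univ.erase k, ellTheta p (z k / z j) =
      ellDelta p z * ∏ j ∈ univ.erase k, ellTheta p (q * z k / z j) := by
  simp only [ellDelta, prod_erase_univ_eq_prod_Ioi, ← prod_mul_distrib]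
  refine prod_congr rfl fun j _ => prod_congr rfl fun l hl => ?_
  have hjl := mem_Ioi.mp hl
  by_cases hlk : l = k
  · subst hlk
    simp only [if_true, Function.update_self, Function.update_of_ne hjl.ne]
    ring
  by_cases hjk : j = k
  · subst hjk
    simp only [if_true, if_neg hlk, Function.update_self, Function.update_of_ne hlk]
    have hj := hz j
    have hl := hz l
    rw [ellTheta_div_comm hp hj hl, ellTheta_div_comm hp (mul_ne_zero hq hj) hl]
    field_simp
  · simp only [if_neg hlk, if_neg hjk, Function.update_of_ne hlk, Function.update_of_ne hjk]

lemma ellDelta_ne_zero_iff {p : ℂ} (hp : ‖p‖ < 1) {n : ℕ} {z : Fin n → ℂ} (hz : ∀ k, z k ≠ 0) :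
    ellDelta p z ≠ 0 ↔ ∀ j k, j ≠ k → ellTheta p (z k / z j) ≠ 0 := by
  simp only [ellDelta, prod_ne_zero_iff, mem_univ, mem_Ioi, forall_true_left]
  constructor
  · intro h j k hjk
    rcases hjk.lt_or_gt with hlt | hgt
    · exact right_ne_zero_of_mul (h j k hlt)
    · rw [ellTheta_div_comm hp (hz j) (hz k), neg_mul, neg_ne_zero]
      exact mul_ne_zero (div_ne_zero (hz k) (hz j))
        (right_ne_zero_of_mul (h k j hgt))
  · exact fun h j k hjk => mul_ne_zero (hz j) (h j k hjk.ne)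

lemma ellPoch_succ (p q a : ℂ) (k : ℕ) :
    ellPoch p q a (k + 1) = ellPoch p q a k * ellTheta p (a * q ^ k) :=
  prod_range_succ _ _

lemma ellPoch_succ' (p q a : ℂ) (k : ℕ) :
    ellPoch p q a (k + 1) = ellTheta p a * ellPoch p q (q * a) k := by
  rw [ellPoch, prod_range_succ', pow_zero, mul_one, mul_comm]
  congr 1
  exact prod_congr rfl fun i _ => by rw [pow_succ]; congr 1; ring

lemma ellPoch_ne_zero_iff {p q a : ℂ} {k : ℕ} :
    ellPoch p q a k ≠ 0 ↔ ∀ i < k, ellTheta p (a * q ^ i) ≠ 0 := by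
  simp [ellPoch, prod_ne_zero_iff]

lemma prod_apply_update_mul {α : Type*} [Fintype α] [DecidableEq α] (F : ℂ → ℂ) (a : α → ℂ) (i : α)
    {v s t : ℂ} (h : F v * s = F (a i) * t) :
    (∏ j, F (Function.update a i v j)) * s = (∏ j, F (a j)) * t := by
  rw [← mul_prod_erase univ _ (mem_univ i), ← mul_prod_erase univ (fun j => F (a j)) (mem_univ i),
    Function.update_self]
  have : ∏ j ∈ univ.erase i, F (Function.update a i v j) = ∏ j ∈ univ.erase i, F (a j) :=
    prod_congr rfl fun j hj => by rw [Function.update_of_ne (mem_erase.mp hj).1]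
  rw [this]
  linear_combination (∏ j ∈ univ.erase i, F (a j)) * h

/-- The map y ↦ Y = y + e_k is a bijection onto the tuples with Y_k > 0; the remaining tuples
contribute nothing by `hF`. -/
lemma sum_antidiagonalTuple_update {n : ℕ} (M : ℕ) (F : (Fin n → ℕ) → Fin n → ℂ)
    (hF : ∀ Y k, Y k = 0 → F Y k = 0) :
    ∑ y ∈ Nat.antidiagonalTuple n M, ∑ k, F (Function.update y k (y k + 1)) k =
      ∑ Y ∈ Nat.antidiagonalTuple n (M + 1), ∑ k, F Y k := by
  have hsum (y : Fin n → ℕ) (k : Fin n) (v : ℕ) :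
      ∑ i, Function.update y k v i + y k = ∑ i, y i + v := by
    rw [← add_sum_erase univ _ (mem_univ k), ← add_sum_erase univ y (mem_univ k),
      Function.update_self]
    have : ∑ j ∈ univ.erase k, Function.update y k v j = ∑ j ∈ univ.erase k, y j :=
      sum_congr rfl fun j hj => by rw [Function.update_of_ne (mem_erase.mp hj).1]
    omega
  rw [sum_comm, sum_comm (s := Nat.antidiagonalTuple n (M + 1))]
  refine sum_congr rfl fun k _ => ?_
  rw [← sum_filter_of_ne (s := Nat.antidiagonalTuple n (M + 1)) (p := fun Y => Y k ≠ 0)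
    fun Y _ h h0 => h (hF Y k h0)]
  refine sum_nbij' (fun y => Function.update y k (y k + 1))
    (fun Y => Function.update Y k (Y k - 1)) ?_ ?_ ?_ ?_ fun _ _ => rfl
  · intro y hy
    rw [Nat.mem_antidiagonalTuple] at hy
    have := hsum y k (y k + 1)
    rw [mem_filter, Nat.mem_antidiagonalTuple, Function.update_self]
    omega
  · intro Y hY
    rw [mem_filter, Nat.mem_antidiagonalTuple] at hY
    have := hsum Y k (Y k - 1)
    rw [Nat.mem_antidiagonalTuple]
    omega
  · intro y _
    simp
  · intro Y hY
    have : Y k - 1 + 1 = Y k := by have := (mem_filter.mp hY).2; omega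
    simp [this]

lemma prod_ellTheta_inv {α : Type*} {p : ℂ} (hp : ‖p‖ < 1) (s : Finset α) {f : α → ℂ}
    (hf : ∀ i ∈ s, f i ≠ 0) :
    ∏ i ∈ s, ellTheta p (f i)⁻¹ = (-1) ^ s.card * (∏ i ∈ s, f i)⁻¹ * ∏ i ∈ s, ellTheta p (f i) := by
  rw [← prod_const, ← prod_inv_distrib, ← prod_mul_distrib, ← prod_mul_distrib]
  refine prod_congr rfl fun i hi => ?_
  rw [ellTheta_inv hp (hf i hi)]
  ring

/-- The elliptic partial fraction identity, as a duality between sums over two sets of poles. -/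
theorem sum_prod_ellTheta_div_eq_sum {p : ℂ} (hp : ‖p‖ < 1) {ι κ α : Type*} [Fintype ι]
    [Fintype κ] [Fintype α] [DecidableEq ι] [DecidableEq κ]
    (hcard : Fintype.card α = Fintype.card κ + Fintype.card ι) {x : ι → ℂ} {w : κ → ℂ} {c : α → ℂ}
    (hx : ∀ i, x i ≠ 0) (hw : ∀ i, w i ≠ 0) (hc : ∀ i, c i ≠ 0)
    (hxx : ∀ i j, i ≠ j → ellTheta p (x i / x j) ≠ 0)
    (hww : ∀ i j, i ≠ j → ellTheta p (w i / w j) ≠ 0)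
    (hwx : ∀ l k, ellTheta p (w l * x k) ≠ 0)
    (hbal : ∏ l, w l = (∏ k, x k) * ∏ j, c j) :
    ∑ k, (∏ j, ellTheta p (c j * x k)) /
        ((∏ j ∈ univ.erase k, ellTheta p (x k / x j)) * ∏ l, ellTheta p (w l * x k)) =
      ∑ l, (∏ j, ellTheta p (w l / c j)) /
        ((∏ j ∈ univ.erase l, ellTheta p (w l / w j)) * ∏ k, ellTheta p (w l * x k)) := by
  have hX : ∏ k, x k ≠ 0 := prod_ne_zero_iff.mpr fun k _ => hx k
  have hW : ∏ l, w l ≠ 0 := prod_ne_zero_iff.mpr fun k _ => hw k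
  have hC : ∏ j, c j ≠ 0 := prod_ne_zero_iff.mpr fun k _ => hc k
  -- With nodes x_k and 1/w_l, the partial fraction identity splits into the two sides of the
  -- duality.
  let X : ι ⊕ κ → ℂ := Sum.elim x fun l => (w l)⁻¹
  have hX0 : ∀ i, X i ≠ 0 := by
    rintro (i | i)
    exacts [hx i, inv_ne_zero (hw i)]
  have key := sum_prod_ellTheta_div_eq_zero hp (univ : Finset (ι ⊕ κ)) X
    (univ.val.map c) (by simp [hcard, add_comm]) (fun i _ => hX0 i)
    (fun a ha => by
      obtain ⟨j, _, rfl⟩ := Multiset.mem_map.mp ha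
      exact hc j)
    (by
      rintro (i | i) - (j | j) - hij
      · exact hxx i j (by simpa using hij)
      · simpa [X, mul_comm] using hwx j i
      · change ellTheta p ((w i)⁻¹ / x j) ≠ 0
        rw [show (w i)⁻¹ / x j = (w i * x j)⁻¹ by rw [mul_inv, div_eq_mul_inv],
          ellTheta_inv hp (mul_ne_zero (hw i) (hx j))]
        exact div_ne_zero (neg_ne_zero.mpr (hwx i j)) (mul_ne_zero (hw i) (hx j))
      · change ellTheta p ((w i)⁻¹ / (w j)⁻¹) ≠ 0
        rw [inv_div_inv]
        exact hww j i (by simpa [eq_comm] using hij))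
    (by
      change (∏ i, X i) * ∏ j, c j = 1
      simp only [X, Fintype.prod_sum_type, Sum.elim_inl, Sum.elim_inr, prod_inv_distrib]
      rw [hbal]
      field_simp)
  have hmap (v : ℂ) : ((univ.val.map c).map fun a => ellTheta p (v * a)).prod =
      ∏ j, ellTheta p (v * c j) := by
    rw [Multiset.map_map]
    rfl
  have herase_l (k : ι) (f : ι ⊕ κ → ℂ) : ∏ j ∈ univ.erase (Sum.inl k), f j =
      (∏ j ∈ univ.erase k, f (Sum.inl j)) * ∏ l, f (Sum.inr l) := by
    have : (univ : Finset (ι ⊕ κ)).erase (Sum.inl k) = (univ.erase k).disjSum univ := by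
      ext (i | i) <;> simp
    rw [this, prod_disjSum]
  have herase_r (l : κ) (f : ι ⊕ κ → ℂ) : ∏ j ∈ univ.erase (Sum.inr l), f j =
      (∏ k, f (Sum.inl k)) * ∏ j ∈ univ.erase l, f (Sum.inr j) := by
    have : (univ : Finset (ι ⊕ κ)).erase (Sum.inr l) = univ.disjSum (univ.erase l) := by
      ext (i | i) <;> simp
    rw [this, prod_disjSum]
  simp only [hmap, Fintype.sum_sum_type, herase_l, herase_r, X, Sum.elim_inl, Sum.elim_inr] at key
  have hleft (k : ι) : (∏ j, ellTheta p (x k * c j)) /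
        ((∏ j ∈ univ.erase k, ellTheta p (x k / x j)) * ∏ l, ellTheta p (x k / (w l)⁻¹)) =
      (∏ j, ellTheta p (c j * x k)) /
        ((∏ j ∈ univ.erase k, ellTheta p (x k / x j)) * ∏ l, ellTheta p (w l * x k)) := by
    simp only [div_inv_eq_mul, mul_comm]
  have hright (l : κ) : (∏ j, ellTheta p ((w l)⁻¹ * c j)) /
        ((∏ k, ellTheta p ((w l)⁻¹ / x k)) *
          ∏ j ∈ univ.erase l, ellTheta p ((w l)⁻¹ / (w j)⁻¹)) =
      -((∏ j, ellTheta p (w l / c j)) /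
        ((∏ j ∈ univ.erase l, ellTheta p (w l / w j)) * ∏ k, ellTheta p (w l * x k))) := by
    have e1 : ∏ j, ellTheta p ((w l)⁻¹ * c j) = (-1) ^ Fintype.card α *
        (∏ j, w l / c j)⁻¹ * ∏ j, ellTheta p (w l / c j) := by
      rw [← card_univ, ← prod_ellTheta_inv hp univ fun j _ => div_ne_zero (hw l) (hc j)]
      exact prod_congr rfl fun j _ => by rw [inv_div]; congr 1; field_simp
    have e2 : ∏ k, ellTheta p ((w l)⁻¹ / x k) = (-1) ^ Fintype.card ι *
        (∏ k, w l * x k)⁻¹ * ∏ k, ellTheta p (w l * x k) := by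
      rw [← card_univ, ← prod_ellTheta_inv hp univ fun j _ => mul_ne_zero (hw l) (hx j)]
      exact prod_congr rfl fun j _ => by rw [mul_inv, div_eq_mul_inv]
    have e3 : ∏ j ∈ univ.erase l, ellTheta p ((w l)⁻¹ / (w j)⁻¹) =
        (-1) ^ (Fintype.card κ - 1) * (∏ j ∈ univ.erase l, w l / w j)⁻¹ *
          ∏ j ∈ univ.erase l, ellTheta p (w l / w j) := by
      rw [← card_univ, ← card_erase_of_mem (mem_univ l),
        ← prod_ellTheta_inv hp _ fun j _ => div_ne_zero (hw l) (hw j)]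
      exact prod_congr rfl fun j _ => by rw [inv_div, inv_div_inv]
    have n1 : ∏ j ∈ univ.erase l, ellTheta p (w l / w j) ≠ 0 :=
      prod_ne_zero_iff.mpr fun j hj => hww l j (mem_erase.mp hj).1.symm
    have n2 : ∏ k, ellTheta p (w l * x k) ≠ 0 := prod_ne_zero_iff.mpr fun k _ => hwx l k
    have e4 : ∏ j ∈ univ.erase l, w l / w j = ∏ j, w l / w j := by
      rw [← mul_prod_erase univ _ (mem_univ l), div_self (hw l), one_mul]
    obtain ⟨r, hr⟩ : ∃ r, Fintype.card κ = r + 1 :=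
      Nat.exists_eq_succ_of_ne_zero (Fintype.card_pos_iff.mpr ⟨l⟩).ne'
    -- The signs combine to -1 because |α| = |κ| + |ι|; the monomials cancel because of the
    -- balancing condition.
    rw [e1, e2, e3, e4, prod_div_distrib, prod_div_distrib, prod_mul_distrib, prod_const,
      prod_const, prod_const, card_univ, card_univ, card_univ, hcard, hr, hbal]
    have := hw l
    simp only [Nat.add_sub_cancel, pow_add, pow_one]
    have s1 : ((-1 : ℂ) ^ r) ^ 2 = 1 := by rw [← pow_mul, pow_mul', neg_one_sq, one_pow]
    field_simp
  rw [sum_congr rfl fun k _ => hleft k, sum_congr rfl fun l _ => hright l, sum_neg_distrib,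
    add_neg_eq_zero] at key
  exact key

end

/-! ### Kajihara summands and their behaviour under q-shifts. -/

noncomputable section

variable {p q : ℂ} {n m : ℕ} {α : Type*} [Fintype α]

/-- The factor of the Kajihara summand that belongs to one summation index. -/
def kajiharaFactor (p q : ℂ) {n m : ℕ} {α : Type*} [Fintype α] (z : Fin n → ℂ) (w : Fin m → ℂ)
    (a : α → ℂ) (x : ℂ) (s : ℕ) : ℂ :=
  (∏ j, ellPoch p q (a j * x) s) /
    ((∏ j, ellPoch p q (w j * x) s) * ∏ j, ellPoch p q (q * x / z j) s)

/-- The summand of the elliptic Kajihara series. -/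
def kajiharaTerm (p q : ℂ) {n m : ℕ} {α : Type*} [Fintype α] (z : Fin n → ℂ) (w : Fin m → ℂ)
    (a : α → ℂ) (y : Fin n → ℕ) : ℂ :=
  ellDelta p (fun k => z k * q ^ y k) / ellDelta p z * ∏ k, kajiharaFactor p q z w a (z k) (y k)

/-- The elliptic Kajihara series of degree `N`. -/
def kajiharaSum (p q : ℂ) {n m : ℕ} {α : Type*} [Fintype α] (z : Fin n → ℂ) (w : Fin m → ℂ)
    (a : α → ℂ) (N : ℕ) : ℂ :=
  ∑ y ∈ Nat.antidiagonalTuple n N, kajiharaTerm p q z w a y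

lemma ellPoch_mul_left (x : ℂ) (s : ℕ) :
    ellPoch p q (q * x) s * ellTheta p x = ellPoch p q x s * ellTheta p (x * q ^ s) := by
  rw [← ellPoch_succ, ellPoch_succ', mul_comm]

lemma kajiharaFactor_succ (z : Fin n → ℂ) (w : Fin m → ℂ) (a : α → ℂ) (x : ℂ) (s : ℕ)
    (hw : ∀ l, ellTheta p (w l * (x * q ^ s)) ≠ 0)
    (hz : ∀ j, ellTheta p (q * (x * q ^ s) / z j) ≠ 0) :
    kajiharaFactor p q z w a x (s + 1) *
        ((∏ l, ellTheta p (w l * (x * q ^ s))) * ∏ j, ellTheta p (q * (x * q ^ s) / z j)) =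
      kajiharaFactor p q z w a x s * ∏ j, ellTheta p (a j * (x * q ^ s)) := by
  have h1 : ∏ l, ellTheta p (w l * (x * q ^ s)) ≠ 0 := prod_ne_zero_iff.mpr fun l _ => hw l
  have h2 : ∏ j, ellTheta p (q * (x * q ^ s) / z j) ≠ 0 := prod_ne_zero_iff.mpr fun l _ => hz l
  have e (j : Fin n) : q * x / z j * q ^ s = q * (x * q ^ s) / z j := by ring
  have e' (v : ℂ) : v * x * q ^ s = v * (x * q ^ s) := mul_assoc v x _
  simp only [kajiharaFactor, ellPoch_succ, prod_mul_distrib, e, e']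
  generalize ∏ l, ellTheta p (w l * (x * q ^ s)) = B at *
  generalize ∏ j, ellTheta p (q * (x * q ^ s) / z j) = C at *
  generalize ∏ j, ellPoch p q (w j * x) s = B', ∏ j, ellPoch p q (q * x / z j) s = C'
  generalize ∏ j, ellPoch p q (a j * x) s = A, ∏ j, ellTheta p (a j * (x * q ^ s)) = A'
  field_simp

/-- A shift of one numerator and one denominator parameter, as it occurs on the left side. -/
lemma kajiharaFactor_update [DecidableEq α] (z : Fin n → ℂ) (w : Fin m → ℂ) (a : α → ℂ)
    (x : ℂ) (s : ℕ) (l : Fin m) (i : α) (ha : ellTheta p (a i * x) ≠ 0)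
    (hw : ellTheta p (w l * x) ≠ 0) (hw' : ellTheta p (w l * (x * q ^ s)) ≠ 0) :
    kajiharaFactor p q z (Function.update w l (q * w l)) (Function.update a i (q * a i)) x s =
      kajiharaFactor p q z w a x s * (ellTheta p (a i * (x * q ^ s)) / ellTheta p (a i * x) *
        (ellTheta p (w l * x) / ellTheta p (w l * (x * q ^ s)))) := by
  have h1 := prod_apply_update_mul (fun v => ellPoch p q (v * x) s) a i (v := q * a i)
    (s := ellTheta p (a i * x)) (t := ellTheta p (a i * (x * q ^ s)))
    (by simp only [mul_assoc q, ← mul_assoc _ x]; exact ellPoch_mul_left _ _)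
  have h2 := prod_apply_update_mul (fun v => ellPoch p q (v * x) s) w l (v := q * w l)
    (s := ellTheta p (w l * x)) (t := ellTheta p (w l * (x * q ^ s)))
    (by simp only [mul_assoc q, ← mul_assoc _ x]; exact ellPoch_mul_left _ _)
  rw [kajiharaFactor, kajiharaFactor, eq_div_of_mul_eq ha h1, eq_div_of_mul_eq hw h2]
  generalize ∏ j, ellPoch p q (w j * x) s = B, ∏ j, ellPoch p q (q * x / z j) s = C
  generalize ∏ j, ellPoch p q (a j * x) s = A
  generalize ellTheta p (a i * x) = s at *
  generalize ellTheta p (w l * x) = v at *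
  generalize ellTheta p (w l * (x * _)) = u at *
  generalize ellTheta p (a i * (x * _)) = t at *
  field_simp

/-- On the right side w is the vector of base points; this treats the factors whose own base point
is not shifted. -/
lemma kajiharaFactor_update_of_ne [DecidableEq α] (hq : q ≠ 0) (z : Fin n → ℂ) (w : Fin m → ℂ)
    (b : α → ℂ) (x : ℂ) (s : ℕ) (l : Fin m) (i : α)
    (hb : ellTheta p (b i / q * (x * q ^ s)) ≠ 0)
    (hw : ellTheta p (x / w l) ≠ 0) (hw' : ellTheta p (x * q ^ s / w l) ≠ 0) :
    kajiharaFactor p q (Function.update w l (q * w l)) z (Function.update b i (b i / q)) x s =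
      kajiharaFactor p q w z b x s * (ellTheta p (b i / q * x) / ellTheta p (b i / q * (x * q ^ s)) *
        (ellTheta p (x * q ^ s / w l) / ellTheta p (x / w l))) := by
  have h1 := prod_apply_update_mul (fun v => ellPoch p q (v * x) s) b i (v := b i / q)
    (s := ellTheta p (b i / q * (x * q ^ s))) (t := ellTheta p (b i / q * x)) (by
      have := ellPoch_mul_left (p := p) (q := q) (b i / q * x) s
      rw [show q * (b i / q * x) = b i * x by field_simp, mul_assoc _ x] at this
      exact this.symm)
  have h2 := prod_apply_update_mul (fun v => ellPoch p q (q * x / v) s) w l (v := q * w l)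
    (s := ellTheta p (x * q ^ s / w l)) (t := ellTheta p (x / w l)) (by
      have := ellPoch_mul_left (p := p) (q := q) (x / w l) s
      rw [show q * (x / w l) = q * x / w l by ring,
        show x / w l * q ^ s = x * q ^ s / w l by ring] at this
      rw [mul_div_mul_left _ _ hq]
      exact this.symm)
  rw [kajiharaFactor, kajiharaFactor, eq_div_of_mul_eq hb h1, eq_div_of_mul_eq hw' h2]
  generalize ∏ j, ellPoch p q (z j * x) s = B, ∏ j, ellPoch p q (q * x / w j) s = C
  generalize ∏ j, ellPoch p q (b j * x) s = A
  generalize ellTheta p (b i / q * (x * _)) = s at *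
  generalize ellTheta p (x / w l) = v at *
  generalize ellTheta p (x * _ / w l) = u at *
  generalize ellTheta p (b i / q * x) = t at *
  field_simp

/-- The factor whose base point is shifted: starting at q w_l with s steps is starting at w_l with s
+ 1 steps, the first one removed. -/
lemma kajiharaFactor_update_self [DecidableEq α] (hq : q ≠ 0) (z : Fin n → ℂ) (w : Fin m → ℂ)
    (b : α → ℂ) (s : ℕ) (l : Fin m) (i : α) (hwl : w l ≠ 0)
    (hz : ∀ j, ellTheta p (z j * w l) ≠ 0)
    (hw : ∀ j ∈ univ.erase l, ellTheta p (q * w l / w j) ≠ 0)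
    (hs : ellTheta p (w l * q ^ (s + 1) / w l) ≠ 0) :
    kajiharaFactor p q (Function.update w l (q * w l)) z (Function.update b i (b i / q))
        (q * w l) s * ((∏ j ∈ univ.erase i, ellTheta p (b j * w l)) *
          ellTheta p (b i / q * (w l * q ^ (s + 1)))) =
      kajiharaFactor p q w z b (w l) (s + 1) * ((∏ j, ellTheta p (z j * w l)) *
        ((∏ j ∈ univ.erase l, ellTheta p (q * w l / w j)) *
          ellTheta p (w l * q ^ (s + 1) / w l))) := by
  have n1 : ∏ j, ellTheta p (z j * w l) ≠ 0 := prod_ne_zero_iff.mpr fun j _ => hz j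
  have n2 : ∏ j ∈ univ.erase l, ellTheta p (q * w l / w j) ≠ 0 := prod_ne_zero_iff.mpr hw
  have h1 : (∏ j, ellPoch p q (Function.update b i (b i / q) j * (q * w l)) s) *
      ((∏ j ∈ univ.erase i, ellTheta p (b j * w l)) *
          ellTheta p (b i / q * (w l * q ^ (s + 1)))) =
      ∏ j, ellPoch p q (b j * w l) (s + 1) := by
    rw [← mul_prod_erase univ _ (mem_univ i),
      ← mul_prod_erase univ (fun j => ellPoch p q (b j * w l) (s + 1)) (mem_univ i),
      Function.update_self, ellPoch_succ]
    have e : ∏ j ∈ univ.erase i, ellPoch p q (Function.update b i (b i / q) j * (q * w l)) s *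
        ellTheta p (b j * w l) = ∏ j ∈ univ.erase i, ellPoch p q (b j * w l) (s + 1) :=
      prod_congr rfl fun j hj => by
        rw [Function.update_of_ne (mem_erase.mp hj).1, ellPoch_succ', mul_comm,
          mul_left_comm (b j)]
    rw [← e, prod_mul_distrib, show b i / q * (q * w l) = b i * w l by field_simp,
      show b i / q * (w l * q ^ (s + 1)) = b i * w l * q ^ s by rw [pow_succ]; field_simp]
    ring
  have h2 : (∏ j, ellPoch p q (z j * (q * w l)) s) * ∏ j, ellTheta p (z j * w l) =
      ∏ j, ellPoch p q (z j * w l) (s + 1) := by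
    rw [← prod_mul_distrib]
    exact prod_congr rfl fun j _ => by rw [ellPoch_succ', mul_comm, mul_left_comm (z j)]
  have h3 : (∏ j, ellPoch p q (q * (q * w l) / Function.update w l (q * w l) j) s) *
      ((∏ j ∈ univ.erase l, ellTheta p (q * w l / w j)) *
          ellTheta p (w l * q ^ (s + 1) / w l)) =
      ∏ j, ellPoch p q (q * w l / w j) (s + 1) := by
    rw [← mul_prod_erase univ _ (mem_univ l),
      ← mul_prod_erase univ (fun j => ellPoch p q (q * w l / w j) (s + 1)) (mem_univ l),
      Function.update_self, ellPoch_succ]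
    have e : ∏ j ∈ univ.erase l,
          ellPoch p q (q * (q * w l) / Function.update w l (q * w l) j) s *
          ellTheta p (q * w l / w j) =
        ∏ j ∈ univ.erase l, ellPoch p q (q * w l / w j) (s + 1) :=
      prod_congr rfl fun j hj => by
        rw [Function.update_of_ne (mem_erase.mp hj).1, ellPoch_succ', mul_comm, mul_div_assoc q (q * w l)]
    rw [← e, prod_mul_distrib, show q * (q * w l) / (q * w l) = q * w l / w l by field_simp,
      show w l * q ^ (s + 1) / w l = q * w l / w l * q ^ s by rw [pow_succ]; ring]
    ring
  rw [kajiharaFactor, kajiharaFactor, ← h1, ← h2, ← h3]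
  generalize (∏ j ∈ univ.erase i, ellTheta p (b j * w l)) *
          ellTheta p (b i / q * (w l * q ^ (s + 1))) = X
  generalize ∏ j, ellTheta p (z j * w l) = d' at *
  generalize ∏ j ∈ univ.erase l, ellTheta p (q * w l / w j) = c at *
  generalize ellTheta p (w l * q ^ (s + 1) / w l) = d at *
  generalize ∏ j, ellPoch p q (z j * (q * w l)) s = B
  generalize ∏ j, ellPoch p q (Function.update b i (b i / q) j * (q * w l)) s = A
  generalize ∏ j, ellPoch p q (q * (q * w l) / Function.update w l (q * w l) j) s = C
  field_simp

/-- The coefficients of the recursion in the degree satisfied by the Kajihara series. -/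
def kajiharaCoeff (p : ℂ) {n m : ℕ} {α : Type*} [Fintype α] (z : Fin n → ℂ) (w : Fin m → ℂ)
    (c : α → ℂ) (l : Fin m) : ℂ :=
  (∏ j, ellTheta p (w l / c j)) /
    ((∏ j ∈ univ.erase l, ellTheta p (w l / w j)) * ∏ k, ellTheta p (w l * z k))

lemma mul_pow_update (q : ℂ) (z : Fin n → ℂ) (y : Fin n → ℕ) (k : Fin n) :
    (fun j => z j * q ^ Function.update y k (y k + 1) j) =
      Function.update (fun j => z j * q ^ y j) k (q * (z k * q ^ y k)) := by
  funext j
  rcases eq_or_ne j k with rfl | h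
  · simp only [Function.update_self, pow_succ]
    ring
  · simp only [Function.update_of_ne h]

lemma kajiharaTerm_update_succ (hp : ‖p‖ < 1) (hq : q ≠ 0) {z : Fin n → ℂ} (w : Fin m → ℂ)
    (a : α → ℂ) (hz : ∀ k, z k ≠ 0) (y : Fin n → ℕ) (k : Fin n)
    (hwz : ∀ l, ellTheta p (w l * (z k * q ^ y k)) ≠ 0)
    (hzz : ∀ j, ellTheta p (q * (z k * q ^ y k) / z j) ≠ 0) :
    kajiharaTerm p q z w a (Function.update y k (y k + 1)) *
        ((∏ j ∈ univ.erase k, ellTheta p (z k * q ^ y k / (z j * q ^ y j))) *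
          ((∏ l, ellTheta p (w l * (z k * q ^ y k))) *
            ∏ j, ellTheta p (q * (z k * q ^ y k) / z j))) =
      kajiharaTerm p q z w a y *
        ((∏ j ∈ univ.erase k, ellTheta p (q * (z k * q ^ y k) / (z j * q ^ y j))) *
          ∏ j, ellTheta p (a j * (z k * q ^ y k))) := by
  have h1 := ellDelta_update hp hq (z := fun j => z j * q ^ y j)
    (fun j => mul_ne_zero (hz j) (pow_ne_zero _ hq)) k
  have h2 := kajiharaFactor_succ z w a (z k) (y k) hwz hzz
  rw [kajiharaTerm, kajiharaTerm, mul_pow_update,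
    ← mul_prod_erase univ (fun j => kajiharaFactor p q z w a (z j) (y j)) (mem_univ k),
    ← mul_prod_erase univ _ (mem_univ k), Function.update_self]
  have e : ∏ j ∈ univ.erase k,
      kajiharaFactor p q z w a (z j) (Function.update y k (y k + 1) j) =
      ∏ j ∈ univ.erase k, kajiharaFactor p q z w a (z j) (y j) :=
    prod_congr rfl fun j hj => by rw [Function.update_of_ne (mem_erase.mp hj).1]
  rw [e]
  set E := ∏ j ∈ univ.erase k, kajiharaFactor p q z w a (z j) (y j)
  linear_combination (E / ellDelta p z) * (kajiharaFactor p q z w a (z k) (y k + 1) *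
    ((∏ l, ellTheta p (w l * (z k * q ^ y k))) *
            ∏ j, ellTheta p (q * (z k * q ^ y k) / z j)) * h1 +
    ellDelta p (fun j => z j * q ^ y j) *
      (∏ j ∈ univ.erase k, ellTheta p (q * (z k * q ^ y k) / (z j * q ^ y j))) * h2)

end

/-! ### The recursion for the left side. -/

noncomputable section

variable {p q : ℂ} {n m : ℕ} {α : Type*} [Fintype α]

/-- Equal exponents are covered by the Weyl denominator; a difference between 1 and N is covered by
the Pochhammer symbols, after inversion if necessary. -/
lemma ellTheta_shift_ne_zero (hp : ‖p‖ < 1) (hq : q ≠ 0) {z : Fin n → ℂ} (hz : ∀ k, z k ≠ 0)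
    (hzd : ∀ j k, j ≠ k → ellTheta p (z k / z j) ≠ 0) {N : ℕ}
    (hzz : ∀ j k, ∀ i < N, ellTheta p (q * z k / z j * q ^ i) ≠ 0) {s t : ℕ} (hs : s ≤ N)
    (ht : t ≤ N) {j k : Fin n} (hjk : j ≠ k) :
    ellTheta p (z k * q ^ s / (z j * q ^ t)) ≠ 0 := by
  have key (j k : Fin n) (hjk : j ≠ k) (s t : ℕ) (hs : s ≤ N) (hts : t ≤ s) :
      ellTheta p (z k * q ^ s / (z j * q ^ t)) ≠ 0 := by
    obtain ⟨d, rfl⟩ := Nat.exists_eq_add_of_le hts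
    have e : z k * q ^ (t + d) / (z j * q ^ t) = z k / z j * q ^ d := by
      rw [pow_add]
      field_simp
    rw [e]
    rcases d with _ | d
    · simpa using hzd j k hjk
    · have := hzz j k d (by omega)
      rwa [show q * z k / z j * q ^ d = z k / z j * q ^ (d + 1) by rw [pow_succ]; ring] at this
  rcases le_total t s with h | h
  · exact key j k hjk s t hs h
  · have n1 := mul_ne_zero (hz k) (pow_ne_zero s hq)
    have n2 := mul_ne_zero (hz j) (pow_ne_zero t hq)
    rw [ellTheta_div_comm hp n2 n1]
    exact mul_ne_zero (neg_ne_zero.mpr (div_ne_zero n1 n2)) (key k j hjk.symm t s ht h)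

lemma le_of_mem_antidiagonalTuple {N : ℕ} {y : Fin n → ℕ}
    (hy : y ∈ Nat.antidiagonalTuple n N) (k : Fin n) : y k ≤ N := by
  rw [Nat.mem_antidiagonalTuple] at hy
  rw [← hy]
  exact single_le_sum (fun i _ => Nat.zero_le (y i)) (mem_univ k)

lemma prod_mul_pow_of_mem_antidiagonalTuple {N : ℕ} {y : Fin n → ℕ}
    (hy : y ∈ Nat.antidiagonalTuple n N) (z : Fin n → ℂ) :
    ∏ k, z k * q ^ y k = (∏ k, z k) * q ^ N := by
  rw [Nat.mem_antidiagonalTuple] at hy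
  rw [prod_mul_distrib, prod_pow_eq_pow_sum, hy]

/-- The summand of the double sum that interpolates between the degrees `M` and `M + 1`. -/
def leftSummand (p q : ℂ) {n m : ℕ} {α : Type*} [Fintype α] (z : Fin n → ℂ) (w : Fin m → ℂ)
    (a : α → ℂ) (v : ℂ) (M : ℕ) (Y : Fin n → ℕ) (k : Fin n) : ℂ :=
  kajiharaTerm p q z w a Y *
    ((∏ j, ellTheta p (v * (z j * q ^ Y j))) / ∏ j, ellTheta p (v * z j)) *
    ((∏ j : Option (Fin n),
        ellTheta p (j.elim (v / q ^ (M + 1)) (fun j => (z j)⁻¹) * (z k * q ^ Y k))) /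
      ((∏ j ∈ univ.erase k, ellTheta p (z k * q ^ Y k / (z j * q ^ Y j))) *
        ∏ _ : Unit, ellTheta p (v * (z k * q ^ Y k))))

lemma leftSummand_eq_zero {z : Fin n → ℂ} (hz : ∀ k, z k ≠ 0) (w : Fin m → ℂ) (a : α → ℂ) (v : ℂ)
    (M : ℕ) (Y : Fin n → ℕ) (k : Fin n) (hk : Y k = 0) : leftSummand p q z w a v M Y k = 0 := by
  have : ∏ j : Option (Fin n),
      ellTheta p (j.elim (v / q ^ (M + 1)) (fun j => (z j)⁻¹) * (z k * q ^ Y k)) = 0 :=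
    prod_eq_zero (mem_univ (some k)) (by simp [hk, hz k, ellTheta_one])
  rw [leftSummand, this, zero_div, mul_zero]

/-- Partial fractions with nodes z_k q^(Y_k), a single dual parameter v, and numerator parameters
1/z_j and v/q^(M+1). The dual sum is one term, whose products cancel the prefactor in `leftSummand`
and leave θ(q^(M+1)). -/
lemma sum_leftSummand (hp : ‖p‖ < 1) (hq : q ≠ 0) {z : Fin n → ℂ} (w : Fin m → ℂ) (a : α → ℂ)
    {v : ℂ} {M : ℕ} (hz : ∀ k, z k ≠ 0) (hv : v ≠ 0)
    (hzd : ∀ j k, j ≠ k → ellTheta p (z k / z j) ≠ 0)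
    (hzz : ∀ j k, ∀ i < M + 1, ellTheta p (q * z k / z j * q ^ i) ≠ 0)
    (hgen : ∀ k (s : ℕ), ellTheta p (v * (z k * q ^ s)) ≠ 0) {Y : Fin n → ℕ}
    (hY : Y ∈ Nat.antidiagonalTuple n (M + 1)) :
    ∑ k, leftSummand p q z w a v M Y k = ellTheta p (q ^ (M + 1)) * kajiharaTerm p q z w a Y := by
  have hqM : q ^ (M + 1) ≠ 0 := pow_ne_zero _ hq
  have hle := le_of_mem_antidiagonalTuple hY
  have hZ : ∏ k, z k ≠ 0 := prod_ne_zero_iff.mpr fun k _ => hz k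
  have key := sum_prod_ellTheta_div_eq_sum hp (ι := Fin n) (κ := Unit) (α := Option (Fin n))
    (by simp [add_comm]) (x := fun k => z k * q ^ Y k) (w := fun _ => v)
    (c := fun j => j.elim (v / q ^ (M + 1)) fun j => (z j)⁻¹)
    (fun k => mul_ne_zero (hz k) (pow_ne_zero _ hq)) (fun _ => hv)
    (by rintro (_ | j); exacts [div_ne_zero hv hqM, inv_ne_zero (hz j)])
    (fun j k hjk => ellTheta_shift_ne_zero hp hq hz hzd hzz (hle _) (hle _) hjk.symm)
    (fun i j hij => absurd (Subsingleton.elim i j) hij)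
    (fun _ k => hgen k (Y k))
    (by
      simp only [univ_unique, prod_singleton, prod_mul_pow_of_mem_antidiagonalTuple hY,
        Fintype.prod_option, Option.elim, prod_inv_distrib]
      field_simp)
  have hA : ∏ j, ellTheta p (v * (z j * q ^ Y j)) ≠ 0 :=
    prod_ne_zero_iff.mpr fun j _ => hgen j (Y j)
  have hA0 : ∏ j, ellTheta p (v * z j) ≠ 0 :=
    prod_ne_zero_iff.mpr fun j _ => by simpa using hgen j 0
  simp only [leftSummand]
  rw [← mul_sum, key]
  have e : v / (v / q ^ (M + 1)) = q ^ (M + 1) := by field_simp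
  simp only [univ_unique, sum_singleton, Fintype.prod_option, Option.elim, e, div_inv_eq_mul,
    erase_singleton, prod_empty, one_mul]
  generalize ∏ j, ellTheta p (v * (z j * q ^ Y j)) = A at *
  generalize ∏ j, ellTheta p (v * z j) = A0 at *
  field_simp

/-- Passing from y + e_k back to y, the products θ(q z_k q^(y_k)/z_j) cancel, and the factors
containing a_i combine to replace a_i by a_i/q^M in the numerator. -/
lemma leftSummand_update [DecidableEq α] (hp : ‖p‖ < 1) (hq : q ≠ 0) {z : Fin n → ℂ}
    (w : Fin m → ℂ) (a : α → ℂ)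
    {i : α} {M : ℕ} (hz : ∀ k, z k ≠ 0)
    (hzd : ∀ j k, j ≠ k → ellTheta p (z k / z j) ≠ 0)
    (hzz : ∀ j k, ∀ s < M + 1, ellTheta p (q * z k / z j * q ^ s) ≠ 0)
    (hwz : ∀ l k, ∀ s < M + 1, ellTheta p (w l * z k * q ^ s) ≠ 0)
    (hgen : ∀ k (s : ℕ), ellTheta p (a i * (z k * q ^ s)) ≠ 0) {y : Fin n → ℕ}
    (hy : y ∈ Nat.antidiagonalTuple n M) (k : Fin n) :
    leftSummand p q z w a (a i) M (Function.update y k (y k + 1)) k =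
      kajiharaTerm p q z w a y *
        ((∏ j, ellTheta p (a i * (z j * q ^ y j))) / ∏ j, ellTheta p (a i * z j)) *
        ((∏ j, ellTheta p (Function.update a i (a i / q ^ M) j * (z k * q ^ y k))) /
          ((∏ j ∈ univ.erase k, ellTheta p (z k * q ^ y k / (z j * q ^ y j))) *
            ∏ l, ellTheta p (w l * (z k * q ^ y k)))) := by
  have hle := le_of_mem_antidiagonalTuple hy
  have hw' (l) : ellTheta p (w l * (z k * q ^ y k)) ≠ 0 := by
    rw [← mul_assoc]
    exact hwz l k _ (Nat.lt_succ_of_le (hle k))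
  have hz' (j) : ellTheta p (q * (z k * q ^ y k) / z j) ≠ 0 := by
    rw [show q * (z k * q ^ y k) / z j = q * z k / z j * q ^ y k by ring]
    exact hzz j k _ (Nat.lt_succ_of_le (hle k))
  have H := kajiharaTerm_update_succ hp hq w a hz y k hw' hz'
  have hB : ∏ l, ellTheta p (w l * (z k * q ^ y k)) ≠ 0 := prod_ne_zero_iff.mpr fun l _ => hw' l
  have hE1 : ∏ j ∈ univ.erase k, ellTheta p (z k * q ^ y k / (z j * q ^ y j)) ≠ 0 :=
    prod_ne_zero_iff.mpr fun j hj => ellTheta_shift_ne_zero hp hq hz hzd hzz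
      ((hle k).trans M.le_succ) ((hle j).trans M.le_succ) (mem_erase.mp hj).1
  have hE2 : ∏ j ∈ univ.erase k, ellTheta p (q * (z k * q ^ y k) / (z j * q ^ y j)) ≠ 0 :=
    prod_ne_zero_iff.mpr fun j hj => by
      rw [show q * (z k * q ^ y k) = z k * q ^ (y k + 1) by ring]
      exact ellTheta_shift_ne_zero hp hq hz hzd hzz
        (Nat.succ_le_succ (hle k)) ((hle j).trans M.le_succ) (mem_erase.mp hj).1
  have hA0 : ∏ j, ellTheta p (a i * z j) ≠ 0 :=
    prod_ne_zero_iff.mpr fun j _ => by simpa using hgen j 0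
  have hu := hgen k (y k)
  have hu' := hgen k (y k + 1)
  rw [show z k * q ^ (y k + 1) = q * (z k * q ^ y k) by ring] at hu'
  have hc := prod_apply_update_mul (fun v => ellTheta p (v * (z k * q ^ y k))) a i
    (v := a i / q ^ M) (s := ellTheta p (a i * (z k * q ^ y k)))
    (t := ellTheta p (a i / q ^ M * (z k * q ^ y k))) (mul_comm _ _)
  have hY (j) : z j * q ^ Function.update y k (y k + 1) j =
      Function.update (fun j => z j * q ^ y j) k (q * (z k * q ^ y k)) j :=
    congrFun (mul_pow_update q z y k) j
  have hopt : ∏ j : Option (Fin n),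
      ellTheta p (j.elim (a i / q ^ (M + 1)) (fun j => (z j)⁻¹) * (q * (z k * q ^ y k))) =
      ellTheta p (a i / q ^ M * (z k * q ^ y k)) *
        ∏ j, ellTheta p (q * (z k * q ^ y k) / z j) := by
    rw [Fintype.prod_option]
    congr 1
    · simp only [Option.elim]
      congr 1
      rw [pow_succ]
      field_simp
    · exact prod_congr rfl fun j _ => by rw [Option.elim, inv_mul_eq_div]
  have hprod : ∏ j, ellTheta p (a i * (z j * q ^ Function.update y k (y k + 1) j)) =
      ellTheta p (a i * (q * (z k * q ^ y k))) *
        ∏ j ∈ univ.erase k, ellTheta p (a i * (z j * q ^ y j)) := by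
    simp only [hY]
    rw [← mul_prod_erase univ _ (mem_univ k), Function.update_self]
    congr 1
    exact prod_congr rfl fun j hj => by rw [Function.update_of_ne (mem_erase.mp hj).1]
  have herase : ∏ j ∈ univ.erase k, ellTheta p (q * (z k * q ^ y k) /
        Function.update (fun j => z j * q ^ y j) k (q * (z k * q ^ y k)) j) =
      ∏ j ∈ univ.erase k, ellTheta p (q * (z k * q ^ y k) / (z j * q ^ y j)) :=
    prod_congr rfl fun j hj => by rw [Function.update_of_ne (mem_erase.mp hj).1]
  rw [leftSummand, hprod]
  have hk : z k * q ^ (y k + 1) = q * (z k * q ^ y k) := by ring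
  simp only [hY, Function.update_self, hk]
  rw [herase, hopt, univ_unique (α := Unit), prod_singleton, eq_div_of_mul_eq hu hc,
    ← mul_prod_erase univ (fun j => ellTheta p (a i * (z j * q ^ y j))) (mem_univ k)]
  generalize kajiharaTerm p q z w a (Function.update y k (y k + 1)) = T' at *
  generalize kajiharaTerm p q z w a y = T at *
  generalize ∏ l, ellTheta p (w l * (z k * q ^ y k)) = B at *
  generalize ∏ j ∈ univ.erase k, ellTheta p (z k * q ^ y k / (z j * q ^ y j)) = E1 at *
  generalize ∏ j ∈ univ.erase k, ellTheta p (q * (z k * q ^ y k) / (z j * q ^ y j)) = E2 at *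
  generalize ∏ j, ellTheta p (a i * z j) = A0 at *
  generalize ∏ j, ellTheta p (q * (z k * q ^ y k) / z j) = C at *
  generalize ∏ j, ellTheta p (a j * (z k * q ^ y k)) = D at *
  generalize ∏ j ∈ univ.erase k, ellTheta p (a i * (z j * q ^ y j)) = R
  generalize ellTheta p (a i * (z k * q ^ y k)) = u at *
  generalize ellTheta p (a i * (q * (z k * q ^ y k))) = u' at *
  generalize ellTheta p (a i / q ^ M * (z k * q ^ y k)) = g
  field_simp
  linear_combination R * g * H

/-- A recursion in the degree, obtained by enlarging the summation indices one at a time. -/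
theorem sum_kajiharaCoeff_mul_left [DecidableEq α] (hp : ‖p‖ < 1) (hq : q ≠ 0)
    (hcard : Fintype.card α = m + n) {z : Fin n → ℂ} {w : Fin m → ℂ} {a : α → ℂ} {i : α} {M : ℕ}
    (hz : ∀ k, z k ≠ 0) (hw : ∀ l, w l ≠ 0) (ha : ∀ j, a j ≠ 0)
    (hzd : ∀ j k, j ≠ k → ellTheta p (z k / z j) ≠ 0)
    (hwd : ∀ j k, j ≠ k → ellTheta p (w k / w j) ≠ 0)
    (hzz : ∀ j k, ∀ s < M + 1, ellTheta p (q * z k / z j * q ^ s) ≠ 0)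
    (hwz : ∀ l k, ∀ s < M + 1, ellTheta p (w l * z k * q ^ s) ≠ 0)
    (hgen : ∀ k (s : ℕ), ellTheta p (a i * (z k * q ^ s)) ≠ 0)
    (hbal : ∏ l, w l = (∏ k, z k) * ∏ j, a j) :
    ∑ l, kajiharaCoeff p z w (Function.update a i (a i / q ^ M)) l *
        kajiharaSum p q z (Function.update w l (q * w l)) (Function.update a i (q * a i)) M =
      ellTheta p (q ^ (M + 1)) * kajiharaSum p q z w a (M + 1) := by
  have hqM : q ^ M ≠ 0 := pow_ne_zero _ hq
  simp only [kajiharaSum, mul_sum]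
  rw [sum_comm, ← sum_congr rfl fun Y hY => sum_leftSummand hp hq w a hz (ha i) hzd hzz hgen hY,
    ← sum_antidiagonalTuple_update M _ fun Y k => leftSummand_eq_zero hz w a (a i) M Y k]
  refine sum_congr rfl fun y hy => ?_
  have hle := le_of_mem_antidiagonalTuple hy
  rw [sum_congr rfl fun k _ => leftSummand_update hp hq w a hz hzd hzz hwz hgen hy k, ← mul_sum]
  have hw' (l k) : ellTheta p (w l * (z k * q ^ y k)) ≠ 0 := by
    rw [← mul_assoc]
    exact hwz l k _ (Nat.lt_succ_of_le (hle k))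
  have hw0 (l k) : ellTheta p (w l * z k) ≠ 0 := by
    simpa using hwz l k 0 M.succ_pos
  have hprod := prod_apply_update_mul id a i (v := a i / q ^ M) (s := q ^ M) (t := 1)
    (by simp only [id]; field_simp)
  -- A second duality, at the nodes z_k q^(y_k), turns the sum over k into one over l. The a_i/q^M
  -- offsets the q^M in the product of the nodes.
  rw [sum_prod_ellTheta_div_eq_sum hp (by simpa using hcard)
    (fun k => mul_ne_zero (hz k) (pow_ne_zero _ hq)) hw
    (fun j => by
      rcases eq_or_ne j i with rfl | h
      · rw [Function.update_self]
        exact div_ne_zero (ha j) hqM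
      · rw [Function.update_of_ne h]
        exact ha j)
    (fun j k hjk => ellTheta_shift_ne_zero hp hq hz hzd hzz ((hle _).trans M.le_succ)
      ((hle _).trans M.le_succ) hjk.symm)
    (fun j k hjk => hwd k j hjk.symm) hw' (by
      simp only [id, mul_one] at hprod
      rw [prod_mul_pow_of_mem_antidiagonalTuple hy, hbal, ← hprod]
      ring), mul_sum]
  refine sum_congr rfl fun l _ => ?_
  have n1 : ∏ k, ellTheta p (w l * (z k * q ^ y k)) ≠ 0 := prod_ne_zero_iff.mpr fun k _ => hw' l k
  have n2 : ∏ k, ellTheta p (w l * z k) ≠ 0 := prod_ne_zero_iff.mpr fun k _ => hw0 l k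
  rw [kajiharaTerm, kajiharaTerm, kajiharaCoeff, prod_congr rfl fun k _ =>
    kajiharaFactor_update z w a (z k) (y k) l i (by simpa using hgen k 0) (hw0 l k) (hw' l k),
    prod_mul_distrib, prod_mul_distrib, prod_div_distrib, prod_div_distrib]
  generalize ∏ k, ellTheta p (w l * (z k * q ^ y k)) = u at *
  generalize ∏ k, ellTheta p (w l * z k) = v at *
  generalize (∏ k, ellTheta p (a i * (z k * q ^ y k))) / _ = r
  generalize ∏ k, kajiharaFactor p q z w a (z k) (y k) = f
  generalize ellDelta p _ / ellDelta p z = d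
  generalize ∏ j, ellTheta p (w l / Function.update a i (a i / q ^ M) j) = g, ∏ j ∈ univ.erase l, ellTheta p (w l / w j) = h
  field_simp

end

/-! ### The recursion for the right side. -/

noncomputable section

variable {p q : ℂ} {n m : ℕ} {α : Type*} [Fintype α]

/-- The summand of the double sum arising when the first step of a summation index is split off. -/
def rightSummand (p q : ℂ) {n m : ℕ} {α : Type*} [Fintype α] (z : Fin n → ℂ) (w : Fin m → ℂ)
    (b : α → ℂ) (c t : ℂ) (Y : Fin m → ℕ) (l : Fin m) : ℂ :=
  kajiharaTerm p q w z b Y *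
    (ellTheta p (w l / c) * (∏ k, ellTheta p (w k * q ^ Y k / w l)) *
      ∏ k ∈ univ.erase l, ellTheta p (w k / t)) /
    ((∏ k, ellTheta p (w k * q ^ Y k / t)) * ∏ k ∈ univ.erase l, ellTheta p (w k / w l))

lemma rightSummand_eq_zero (z : Fin n → ℂ) {w : Fin m → ℂ} (hw : ∀ l, w l ≠ 0) (b : α → ℂ)
    (c t : ℂ) (Y : Fin m → ℕ) (l : Fin m) (hl : Y l = 0) : rightSummand p q z w b c t Y l = 0 := by
  have : ∏ k, ellTheta p (w k * q ^ Y k / w l) = 0 :=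
    prod_eq_zero (mem_univ l) (by simp [hl, hw l, ellTheta_one])
  rw [rightSummand, this, mul_zero, zero_mul, mul_zero, zero_div]

/-- Partial fractions with nodes 1/w_k, a single dual parameter qv, and numerator parameters w_j
q^(Y_j) and v/q^M; again the dual sum is one term. -/
lemma sum_rightSummand (hp : ‖p‖ < 1) (hq : q ≠ 0) (z : Fin n → ℂ) {w : Fin m → ℂ} (b : α → ℂ)
    {v : ℂ} {M : ℕ} (hw : ∀ l, w l ≠ 0) (hv : v ≠ 0)
    (hwd : ∀ j k, j ≠ k → ellTheta p (w k / w j) ≠ 0)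
    (hgen : ∀ k (s : ℕ), ellTheta p (w k * q ^ s / (q * v)) ≠ 0) {Y : Fin m → ℕ}
    (hY : Y ∈ Nat.antidiagonalTuple m (M + 1)) :
    ∑ l, rightSummand p q z w b (v / q ^ M) (q * v) Y l =
      ellTheta p (q ^ (M + 1)) * kajiharaTerm p q w z b Y := by
  have hqM : q ^ M ≠ 0 := pow_ne_zero _ hq
  have hW : ∏ k, w k ≠ 0 := prod_ne_zero_iff.mpr fun k _ => hw k
  have ht : q * v ≠ 0 := mul_ne_zero hq hv
  have hgen0 (k) : ellTheta p (w k / (q * v)) ≠ 0 := by simpa using hgen k 0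
  have hgen' (k) : ellTheta p (q * v / w k) ≠ 0 := by
    rw [ellTheta_div_comm hp (hw k) ht]
    exact mul_ne_zero (neg_ne_zero.mpr (div_ne_zero ht (hw k))) (hgen0 k)
  have key := sum_prod_ellTheta_div_eq_sum hp (ι := Fin m) (κ := Unit) (α := Option (Fin m))
    (by simp [add_comm]) (x := fun k => (w k)⁻¹) (w := fun _ => q * v)
    (c := fun j => j.elim (v / q ^ M) fun j => w j * q ^ Y j)
    (fun k => inv_ne_zero (hw k)) (fun _ => ht)
    (by rintro (_ | j); exacts [div_ne_zero hv hqM, mul_ne_zero (hw j) (pow_ne_zero _ hq)])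
    (fun j k hjk => by rw [inv_div_inv]; exact hwd j k hjk)
    (fun i j hij => absurd (Subsingleton.elim i j) hij)
    (fun _ k => hgen' k)
    (by
      simp only [univ_unique, prod_singleton, prod_mul_pow_of_mem_antidiagonalTuple hY,
        Fintype.prod_option, Option.elim, prod_inv_distrib]
      rw [pow_succ]
      field_simp)
  have hA : ∏ k, ellTheta p (w k * q ^ Y k / (q * v)) ≠ 0 :=
    prod_ne_zero_iff.mpr fun j _ => hgen j (Y j)
  have hA0 : ∏ k, ellTheta p (w k / (q * v)) ≠ 0 := prod_ne_zero_iff.mpr fun j _ => hgen0 j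
  have e : q * v / (v / q ^ M) = q ^ (M + 1) := by rw [pow_succ]; field_simp
  have hratio : (∏ k, ellTheta p (q * v / (w k * q ^ Y k))) / ∏ k, ellTheta p (q * v / w k) =
      (q ^ (M + 1))⁻¹ * ((∏ k, ellTheta p (w k * q ^ Y k / (q * v))) /
        ∏ k, ellTheta p (w k / (q * v))) := by
    have hs := prod_mul_pow_of_mem_antidiagonalTuple (q := q) hY (fun _ => (1 : ℂ))
    simp only [one_mul, prod_const_one] at hs
    rw [← hs, ← prod_inv_distrib, ← prod_div_distrib, ← prod_div_distrib, ← prod_mul_distrib]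
    refine prod_congr rfl fun k _ => ?_
    have hk := hw k
    have hqk : q ^ Y k ≠ 0 := pow_ne_zero _ hq
    rw [ellTheta_div_comm hp (mul_ne_zero hk hqk) ht, ellTheta_div_comm hp hk ht]
    generalize ellTheta p (w k * q ^ Y k / (q * v)) = r
    have := hgen0 k
    generalize ellTheta p (w k / (q * v)) = s at *
    field_simp
  simp only [univ_unique, sum_singleton, prod_singleton, Fintype.prod_option, Option.elim, e,
    erase_singleton, prod_empty, one_mul, inv_div_inv, ← div_eq_mul_inv] at key
  rw [mul_div_assoc, hratio] at key
  have hterm (l : Fin m) : rightSummand p q z w b (v / q ^ M) (q * v) Y l =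
      kajiharaTerm p q w z b Y * (∏ k, ellTheta p (w k / (q * v))) /
        (∏ k, ellTheta p (w k * q ^ Y k / (q * v))) * q ^ (M + 1) *
      ((ellTheta p (v / q ^ M / w l) * ∏ k, ellTheta p (w k * q ^ Y k / w l)) /
        ((∏ k ∈ univ.erase l, ellTheta p (w k / w l)) * ellTheta p (q * v / w l))) := by
    have hwl := hw l
    have hn : ∏ k ∈ univ.erase l, ellTheta p (w k / w l) ≠ 0 :=
      prod_ne_zero_iff.mpr fun k hk => hwd l k (mem_erase.mp hk).1.symm
    rw [rightSummand, ellTheta_div_comm hp hwl (div_ne_zero hv hqM),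
      ellTheta_div_comm hp hwl ht,
      ← mul_prod_erase univ (fun k => ellTheta p (w k / (q * v))) (mem_univ l)]
    have := hgen0 l
    generalize ellTheta p (w l / (v / q ^ M)) = r1
    generalize ellTheta p (w l / (q * v)) = r2 at *
    generalize ∏ k, ellTheta p (w k * q ^ Y k / w l) = r3
    generalize ∏ k, ellTheta p (w k * q ^ Y k / (q * v)) = r4 at *
    generalize ∏ k ∈ univ.erase l, ellTheta p (w k / w l) = r5 at *
    generalize ∏ k ∈ univ.erase l, ellTheta p (w k / (q * v)) = r6
    rw [pow_succ]
    field_simp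
  rw [sum_congr rfl fun l _ => hterm l, ← mul_sum, key]
  generalize ∏ k, ellTheta p (w k / (q * v)) = r2 at *
  generalize ∏ k, ellTheta p (w k * q ^ Y k / (q * v)) = r4 at *
  field_simp

/-- Since (q w_l) q^(y_l) = w_l q^(y_l + 1), the Weyl denominators in the numerators agree; what
remains is a coefficient independent of y. -/
lemma rightSummand_update [DecidableEq α] (hp : ‖p‖ < 1) (hq : q ≠ 0) (z : Fin n → ℂ)
    {w : Fin m → ℂ} {a : α → ℂ} {i : α} {M : ℕ} (hw : ∀ l, w l ≠ 0)
    (hwd : ∀ j k, j ≠ k → ellTheta p (w k / w j) ≠ 0)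
    (hww : ∀ j k, ∀ s < M + 1, ellTheta p (q * w k / w j * q ^ s) ≠ 0)
    (hwz : ∀ l k, ellTheta p (w l * z k) ≠ 0)
    (hgen : ∀ k (s : ℕ), ellTheta p (w k * q ^ s / (q * a i)) ≠ 0) {y : Fin m → ℕ}
    (hy : y ∈ Nat.antidiagonalTuple m M) (l : Fin m) :
    rightSummand p q z w (fun j => (a j)⁻¹) (a i / q ^ M) (q * a i)
        (Function.update y l (y l + 1)) l =
      kajiharaCoeff p z w (Function.update a i (a i / q ^ M)) l *
        kajiharaTerm p q (Function.update w l (q * w l)) z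
          (Function.update (fun j => (a j)⁻¹) i ((a i)⁻¹ / q)) y := by
  have hle := le_of_mem_antidiagonalTuple hy
  have hbt (x : ℂ) : (a i)⁻¹ / q * x = x / (q * a i) := by
    rw [div_mul_eq_mul_div, inv_mul_eq_div, div_div, mul_comm q]
  have hfun : (fun k => Function.update w l (q * w l) k * q ^ y k) =
      fun k => w k * q ^ Function.update y l (y l + 1) k := by
    funext k
    rcases eq_or_ne k l with rfl | h
    · simp only [Function.update_self, pow_succ]
      ring
    · simp only [Function.update_of_ne h]
  have hΔ := ellDelta_update hp hq hw l
  have hΔ0 : ellDelta p w ≠ 0 := (ellDelta_ne_zero_iff hp hw).mpr hwd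
  have hE : ∏ j ∈ univ.erase l, ellTheta p (w l / w j) ≠ 0 :=
    prod_ne_zero_iff.mpr fun j hj => hwd j l (mem_erase.mp hj).1
  have hqw (j) : ellTheta p (q * w l / w j) ≠ 0 := by simpa using hww j l 0 M.succ_pos
  have hE' : ∏ j ∈ univ.erase l, ellTheta p (q * w l / w j) ≠ 0 :=
    prod_ne_zero_iff.mpr fun j _ => hqw j
  have hwl : ellTheta p (w l * q ^ (y l + 1) / w l) ≠ 0 := by
    have := hww l l (y l) (Nat.lt_succ_of_le (hle l))
    rwa [show q * w l / w l * q ^ y l = w l * q ^ (y l + 1) / w l by rw [pow_succ]; ring] at this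
  have hself := kajiharaFactor_update_self (p := p) hq z w (fun j => (a j)⁻¹) (y l) l i (hw l)
    (fun j => by rw [mul_comm]; exact hwz l j) (fun j _ => hqw j) hwl
  have hrest : ∏ k ∈ univ.erase l, kajiharaFactor p q (Function.update w l (q * w l)) z
        (Function.update (fun j => (a j)⁻¹) i ((a i)⁻¹ / q))
        (Function.update w l (q * w l) k) (y k) =
      (∏ k ∈ univ.erase l, kajiharaFactor p q w z (fun j => (a j)⁻¹) (w k) (y k)) *
      ((∏ k ∈ univ.erase l, ellTheta p (w k / (q * a i))) /
          (∏ k ∈ univ.erase l, ellTheta p (w k * q ^ y k / (q * a i))) *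
        ((∏ k ∈ univ.erase l, ellTheta p (w k * q ^ y k / w l)) /
          ∏ k ∈ univ.erase l, ellTheta p (w k / w l))) := by
    rw [← prod_div_distrib, ← prod_div_distrib, ← prod_mul_distrib, ← prod_mul_distrib]
    refine prod_congr rfl fun k hk => ?_
    have hkl := (mem_erase.mp hk).1
    have hshift : ellTheta p (w k * q ^ y k / w l) ≠ 0 := by
      simpa using ellTheta_shift_ne_zero hp hq hw hwd hww ((hle k).trans M.le_succ)
        (Nat.zero_le (M + 1)) hkl.symm
    have := kajiharaFactor_update_of_ne hq z w (fun j => (a j)⁻¹) (w k) (y k) l i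
      (by rw [hbt]; exact hgen k _) (hwd l k hkl.symm) hshift
    rw [Function.update_of_ne hkl, this, hbt, hbt]
  have hcoeff : ∏ j, ellTheta p (w l / Function.update a i (a i / q ^ M) j) =
      ellTheta p (w l / (a i / q ^ M)) *
        ∏ j ∈ univ.erase i, ellTheta p ((a j)⁻¹ * w l) := by
    rw [← mul_prod_erase univ _ (mem_univ i), Function.update_self]
    congr 1
    exact prod_congr rfl fun j hj => by
      rw [Function.update_of_ne (mem_erase.mp hj).1, inv_mul_eq_div]
  have hsplit (F : Fin m → ℕ → ℂ) : ∏ k, F k (Function.update y l (y l + 1) k) =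
      F l (y l + 1) * ∏ k ∈ univ.erase l, F k (y k) := by
    rw [← mul_prod_erase univ _ (mem_univ l), Function.update_self]
    congr 1
    exact prod_congr rfl fun j hj => by rw [Function.update_of_ne (mem_erase.mp hj).1]
  have hzw : ∏ k, ellTheta p (w l * z k) ≠ 0 := prod_ne_zero_iff.mpr fun k _ => hwz l k
  have hzw' : ∏ k, ellTheta p (z k * w l) = ∏ k, ellTheta p (w l * z k) :=
    prod_congr rfl fun k _ => by rw [mul_comm]
  have ht := hgen l (y l + 1)
  rw [rightSummand, kajiharaCoeff, kajiharaTerm, kajiharaTerm, hfun, eq_div_of_mul_eq hE hΔ,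
    hsplit fun k s => ellTheta p (w k * q ^ s / w l),
    hsplit fun k s => ellTheta p (w k * q ^ s / (q * a i)),
    hsplit fun k s => kajiharaFactor p q w z (fun j => (a j)⁻¹) (w k) s,
    ← mul_prod_erase univ (fun k => kajiharaFactor p q (Function.update w l (q * w l)) z
        (Function.update (fun j => (a j)⁻¹) i ((a i)⁻¹ / q))
        (Function.update w l (q * w l) k) (y k)) (mem_univ l), hrest, Function.update_self, hcoeff]
  rw [hbt, hzw'] at hself
  generalize kajiharaFactor p q w z (fun j => (a j)⁻¹) (w l) (y l + 1) = f at *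
  generalize kajiharaFactor p q (Function.update w l (q * w l)) z
    (Function.update (fun j => (a j)⁻¹) i ((a i)⁻¹ / q)) (q * w l) (y l) = f' at *
  generalize ellTheta p (w l * q ^ (y l + 1) / w l) = r1 at *
  generalize ellTheta p (w l * q ^ (y l + 1) / (q * a i)) = r2 at *
  generalize ∏ k, ellTheta p (w l * z k) = r3 at *
  generalize ∏ j ∈ univ.erase i, ellTheta p ((a j)⁻¹ * w l) = r4 at *
  generalize ∏ j ∈ univ.erase l, ellTheta p (q * w l / w j) = r5 at *
  generalize ∏ j ∈ univ.erase l, ellTheta p (w l / w j) = r6 at *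
  generalize ellTheta p (w l / (a i / q ^ M)) = r7
  generalize ellDelta p w = r8 at *
  generalize ellDelta p _ = r9
  generalize ∏ k ∈ univ.erase l, kajiharaFactor p q w z (fun j => (a j)⁻¹) (w k) (y k) = r10
  generalize ∏ k ∈ univ.erase l, ellTheta p (w k / (q * a i)) = r11
  generalize ∏ k ∈ univ.erase l, ellTheta p (w k * q ^ y k / (q * a i)) = r12
  generalize ∏ k ∈ univ.erase l, ellTheta p (w k * q ^ y k / w l) = r13
  generalize ∏ k ∈ univ.erase l, ellTheta p (w k / w l) = r14
  clear hsplit hcoeff hrest hΔ hfun hbt hle hqw hzw' hgen hwz hww hwd hw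
  field_simp
  linear_combination (-(r9 * r10 * r7 * r13 * r11 / (r12 * r14))) * hself

/-- A recursion in the degree, obtained by splitting off the first step of a summation index. -/
theorem sum_kajiharaCoeff_mul_right [DecidableEq α] (hp : ‖p‖ < 1) (hq : q ≠ 0) (z : Fin n → ℂ)
    {w : Fin m → ℂ} {a : α → ℂ} {i : α} {M : ℕ} (hw : ∀ l, w l ≠ 0) (hai : a i ≠ 0)
    (hwd : ∀ j k, j ≠ k → ellTheta p (w k / w j) ≠ 0)
    (hww : ∀ j k, ∀ s < M + 1, ellTheta p (q * w k / w j * q ^ s) ≠ 0)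
    (hwz : ∀ l k, ellTheta p (w l * z k) ≠ 0)
    (hgen : ∀ k (s : ℕ), ellTheta p (w k * q ^ s / (q * a i)) ≠ 0) :
    ∑ l, kajiharaCoeff p z w (Function.update a i (a i / q ^ M)) l *
        kajiharaSum p q (Function.update w l (q * w l)) z
          (Function.update (fun j => (a j)⁻¹) i ((a i)⁻¹ / q)) M =
      ellTheta p (q ^ (M + 1)) * kajiharaSum p q w z (fun j => (a j)⁻¹) (M + 1) := by
  simp only [kajiharaSum, mul_sum]
  rw [sum_comm, ← sum_congr rfl fun Y hY => sum_rightSummand hp hq z _ hw hai hwd hgen hY,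
    ← sum_antidiagonalTuple_update M _ fun Y k => rightSummand_eq_zero z hw _ _ _ Y k]
  -- Unlike on the left, the double sums agree term by term, so no second duality is needed.
  exact sum_congr rfl fun y hy => sum_congr rfl fun l _ =>
    (rightSummand_update hp hq z hw hwd hww hwz hgen hy l).symm

end

/-! ### Induction on the degree and removal of genericity. -/

noncomputable section

variable {p q : ℂ} {n m : ℕ} {α : Type*} [Fintype α]

lemma kajiharaSum_zero {z : Fin n → ℂ} (hΔ : ellDelta p z ≠ 0) (w : Fin m → ℂ) (a : α → ℂ) :
    kajiharaSum p q z w a 0 = 1 := by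
  simp [kajiharaSum, kajiharaTerm, kajiharaFactor, ellPoch, Nat.antidiagonalTuple_zero_right, hΔ]

/-- The deformed parameters occur only in numerators, so no nonvanishing of denominators is
required. -/
lemma continuousAt_kajiharaSum (hp : ‖p‖ < 1) (hq : q ≠ 0) {z : Fin n → ℂ} (hz : ∀ k, z k ≠ 0)
    (w : Fin m → ℂ) (N : ℕ) {g : ℂ → α → ℂ} {s₀ : ℂ} (hg : ∀ j, ContinuousAt (fun s => g s j) s₀)
    (hg0 : ∀ j, g s₀ j ≠ 0) : ContinuousAt (fun s => kajiharaSum p q z w (g s) N) s₀ := by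
  refine tendsto_finsetSum _ fun y _ => Filter.Tendsto.const_mul _ <|
    tendsto_finsetProd _ fun k _ => Filter.Tendsto.div_const
      (tendsto_finsetProd _ fun j _ => tendsto_finsetProd _ fun t _ => ?_) _
  have h := (continuousAt_ellTheta hp
    (mul_ne_zero (mul_ne_zero (hg0 j) (hz k)) (pow_ne_zero t hq)))
  exact ContinuousAt.comp (f := fun s => g s j * z k * q ^ t) h
    (((hg j).mul continuousAt_const).mul continuousAt_const)

/-- The inductive step of the Kajihara transformation, for a generic parameter `a i`. -/
lemma kajiharaSum_succ_eq [DecidableEq α] (hp : ‖p‖ < 1) (hq : q ≠ 0)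
    (hcard : Fintype.card α = m + n) {z : Fin n → ℂ} {w : Fin m → ℂ} {a : α → ℂ} {i : α} {M : ℕ}
    (hz : ∀ k, z k ≠ 0) (hw : ∀ l, w l ≠ 0) (ha : ∀ j, a j ≠ 0)
    (hzd : ∀ j k, j ≠ k → ellTheta p (z k / z j) ≠ 0)
    (hwd : ∀ j k, j ≠ k → ellTheta p (w k / w j) ≠ 0)
    (hzz : ∀ j k, ∀ s < M + 1, ellTheta p (q * z k / z j * q ^ s) ≠ 0)
    (hww : ∀ j k, ∀ s < M + 1, ellTheta p (q * w k / w j * q ^ s) ≠ 0)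
    (hwz : ∀ l k, ∀ s < M + 1, ellTheta p (w l * z k * q ^ s) ≠ 0)
    (hqM : ellTheta p (q ^ (M + 1)) ≠ 0)
    (hgen : ∀ k (s : ℕ), ellTheta p (a i * (z k * q ^ s)) ≠ 0)
    (hgen' : ∀ k (s : ℕ), ellTheta p (w k * q ^ s / (q * a i)) ≠ 0)
    (hbal : ∏ l, w l = (∏ k, z k) * ∏ j, a j)
    (ih : ∀ (w : Fin m → ℂ) (a : α → ℂ), (∀ l, w l ≠ 0) → (∀ j, a j ≠ 0) →
      (∀ j k, j ≠ k → ellTheta p (w k / w j) ≠ 0) →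
      (∀ j k, ∀ s < M, ellTheta p (q * w k / w j * q ^ s) ≠ 0) →
      (∀ l k, ∀ s < M, ellTheta p (w l * z k * q ^ s) ≠ 0) →
      ∏ l, w l = (∏ k, z k) * ∏ j, a j →
      kajiharaSum p q z w a M = kajiharaSum p q w z (fun j => (a j)⁻¹) M) :
    kajiharaSum p q z w a (M + 1) = kajiharaSum p q w z (fun j => (a j)⁻¹) (M + 1) := by
  apply mul_left_cancel₀ hqM
  rw [← sum_kajiharaCoeff_mul_left hp hq hcard hz hw ha hzd hwd hzz hwz hgen hbal,
    ← sum_kajiharaCoeff_mul_right hp hq z hw (ha i) hwd hww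
      (fun l k => by simpa using hwz l k 0 M.succ_pos) hgen']
  refine sum_congr rfl fun l _ => ?_
  congr 1
  have hinv : (fun j => (Function.update a i (q * a i) j)⁻¹) =
      Function.update (fun j => (a j)⁻¹) i ((a i)⁻¹ / q) := by
    funext j
    rcases eq_or_ne j i with rfl | h
    · rw [Function.update_self, Function.update_self, mul_inv, mul_comm, div_eq_mul_inv]
    · rw [Function.update_of_ne h, Function.update_of_ne h]
  -- Exponents 0 or 1 express the shift as powers of q, so the degree M + 1 hypotheses for w give
  -- the degree M ones for the shifted w.
  obtain ⟨e, he1, he⟩ : ∃ e : Fin m → ℕ, (∀ k, e k ≤ 1) ∧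
      ∀ k, Function.update w l (q * w l) k = w k * q ^ e k := by
    refine ⟨fun k => if k = l then 1 else 0, fun k => by dsimp only; split_ifs <;> simp, fun k => ?_⟩
    rcases eq_or_ne k l with rfl | h
    · simp [mul_comm]
    · simp [h]
  rw [← hinv]
  refine ih _ _ (fun k => ?_) (fun j => ?_) (fun j k hjk => ?_) (fun j k s hs => ?_)
    (fun j k s hs => ?_) ?_
  · rw [he]
    exact mul_ne_zero (hw k) (pow_ne_zero _ hq)
  · rcases eq_or_ne j i with rfl | h
    · rw [Function.update_self]
      exact mul_ne_zero hq (ha j)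
    · rw [Function.update_of_ne h]
      exact ha j
  · have h1 := he1 j
    have h2 := he1 k
    rw [he, he]
    exact ellTheta_shift_ne_zero hp hq hw hwd hww (by omega) (by omega) hjk
  · have h2 := he1 k
    have h1 := he1 j
    rw [he, he]
    rcases eq_or_ne j k with rfl | hjk
    · have := pow_ne_zero (e j) hq
      rw [← mul_assoc, mul_div_mul_right _ _ this]
      exact hww j j s (by omega)
    · rw [show q * (w k * q ^ e k) / (w j * q ^ e j) * q ^ s =
        w k * q ^ (s + 1 + e k) / (w j * q ^ e j) by ring]
      exact ellTheta_shift_ne_zero hp hq hw hwd hww (by omega) (by omega) hjk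
  · have h1 := he1 j
    rw [he, show w j * q ^ e j * z k * q ^ s = w j * z k * q ^ (s + e j) by ring]
    exact hwz j k _ (by omega)
  · have h1 := prod_apply_update_mul id w l (v := q * w l) (s := 1) (t := q)
      (by simp only [id]; ring)
    have h2 := prod_apply_update_mul id a i (v := q * a i) (s := 1) (t := q)
      (by simp only [id]; ring)
    simp only [id, mul_one] at h1 h2
    rw [h1, h2, hbal]
    ring

lemma countable_ellTheta_mul_zeros (hp : ‖p‖ < 1) {c : ℂ} (hc : c ≠ 0) :
    {s : ℂ | s ≠ 0 ∧ ellTheta p (c * s) = 0}.Countable := by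
  refine ((countable_ellTheta_zeros hp).preimage (mul_right_injective₀ hc)).mono ?_
  exact fun s hs => ⟨mul_ne_zero hc hs.1, hs.2⟩

lemma countable_ellTheta_div_zeros (hp : ‖p‖ < 1) {c : ℂ} (hc : c ≠ 0) :
    {s : ℂ | s ≠ 0 ∧ ellTheta p (c / s) = 0}.Countable := by
  refine ((countable_ellTheta_mul_zeros hp hc).preimage inv_injective).mono ?_
  exact fun s hs => ⟨inv_ne_zero hs.1, by rw [← div_eq_mul_inv]; exact hs.2⟩

/-- The elliptic Kajihara transformation. -/
theorem kajiharaSum_eq [DecidableEq α] (hp : ‖p‖ < 1) (hq : q ≠ 0)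
    (hcard : Fintype.card α = m + n) (hmn : 2 ≤ m + n) {z : Fin n → ℂ} (N : ℕ)
    (hz : ∀ k, z k ≠ 0) (hzd : ∀ j k, j ≠ k → ellTheta p (z k / z j) ≠ 0)
    (hzz : ∀ j k, ∀ s < N, ellTheta p (q * z k / z j * q ^ s) ≠ 0)
    (hqN : ∀ s < N, ellTheta p (q ^ (s + 1)) ≠ 0)
    (w : Fin m → ℂ) (a : α → ℂ) (hw : ∀ l, w l ≠ 0) (ha : ∀ j, a j ≠ 0)
    (hwd : ∀ j k, j ≠ k → ellTheta p (w k / w j) ≠ 0)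
    (hww : ∀ j k, ∀ s < N, ellTheta p (q * w k / w j * q ^ s) ≠ 0)
    (hwz : ∀ l k, ∀ s < N, ellTheta p (w l * z k * q ^ s) ≠ 0)
    (hbal : ∏ l, w l = (∏ k, z k) * ∏ j, a j) :
    kajiharaSum p q z w a N = kajiharaSum p q w z (fun j => (a j)⁻¹) N := by
  induction N generalizing w a with
  | zero =>
    rw [kajiharaSum_zero ((ellDelta_ne_zero_iff hp hz).mpr hzd),
      kajiharaSum_zero ((ellDelta_ne_zero_iff hp hw).mpr hwd)]
  | succ M ih =>
    have : Nontrivial α := Fintype.one_lt_card_iff_nontrivial.mp (by omega)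
    obtain ⟨i, j, hij⟩ := exists_pair_ne α
    -- Two distinct indices, hence m + n ≥ 2, allow a_i to move while the product of the parameters
    -- stays fixed.
    let g (s : ℂ) : α → ℂ := Function.update (Function.update a i (a i * s)) j (a j / s)
    have hgi (s) : g s i = a i * s := by
      simp only [g, Function.update_of_ne hij, Function.update_self]
    have hg1 : g 1 = a := by simp [g]
    have hg0 (s : ℂ) (hs : s ≠ 0) (k : α) : g s k ≠ 0 := by
      simp only [g, Function.update_apply]
      split_ifs
      exacts [div_ne_zero (ha j) hs, mul_ne_zero (ha i) hs, ha k]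
    have hgprod (s : ℂ) (hs : s ≠ 0) : ∏ k, g s k = ∏ k, a k := by
      have h1 := prod_apply_update_mul id a i (v := a i * s) (s := 1) (t := s)
        (by simp only [id]; ring)
      have h2 := prod_apply_update_mul id (Function.update a i (a i * s)) j (v := a j / s) (s := s)
        (t := 1) (by simp only [id, Function.update_of_ne hij.symm]; field_simp)
      simp only [id, mul_one] at h1 h2
      exact mul_right_cancel₀ hs (h2.trans h1)
    have hgc (k : α) : ContinuousAt (fun s => g s k) 1 := by
      simp only [g, Function.update_apply]
      split_ifs
      exacts [continuousAt_const.div continuousAt_id one_ne_zero,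
        continuousAt_const.mul continuousAt_id, continuousAt_const]
    have hqa : q * a i ≠ 0 := mul_ne_zero hq (ha i)
    -- The values of s at which a denominator of either recursion could vanish, together with 0.
    let S : Set ℂ := {0} ∪ ((⋃ v : Fin n × ℕ,
      {s : ℂ | s ≠ 0 ∧ ellTheta p (a i * (z v.1 * q ^ v.2) * s) = 0}) ∪
      ⋃ v : Fin m × ℕ, {s : ℂ | s ≠ 0 ∧ ellTheta p (w v.1 * q ^ v.2 / (q * a i) / s) = 0})
    have hS : S.Countable := by
      refine (Set.countable_singleton 0).union ((Set.countable_iUnion fun v => ?_).union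
        (Set.countable_iUnion fun v => ?_))
      · exact countable_ellTheta_mul_zeros hp
          (mul_ne_zero (ha i) (mul_ne_zero (hz _) (pow_ne_zero _ hq)))
      · exact countable_ellTheta_div_zeros hp
          (div_ne_zero (mul_ne_zero (hw _) (pow_ne_zero _ hq)) hqa)
    have hgeneric (s : ℂ) (hs : s ∈ Sᶜ) :
        kajiharaSum p q z w (g s) (M + 1) =
          kajiharaSum p q w z (fun j => (g s j)⁻¹) (M + 1) := by
      have hs0 : s ≠ 0 := fun h => hs (Or.inl h)
      refine kajiharaSum_succ_eq hp hq hcard (i := i) hz hw (hg0 s hs0) hzd hwd hzz hww hwz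
        (hqN M M.lt_succ_self) (fun k t h => ?_) (fun k t h => ?_) ?_ ?_
      · refine hs (Or.inr (Or.inl (Set.mem_iUnion.mpr ⟨(k, t), hs0, ?_⟩)))
        rwa [hgi, mul_right_comm] at h
      · refine hs (Or.inr (Or.inr (Set.mem_iUnion.mpr ⟨(k, t), hs0, ?_⟩)))
        rwa [hgi, ← mul_assoc, ← div_div] at h
      · rw [hgprod s hs0, hbal]
      · exact fun w a hw ha hwd hww hwz hbal =>
          ih (fun j k s hs => hzz j k s (hs.trans M.lt_succ_self))
            (fun s hs => hqN s (hs.trans M.lt_succ_self)) w a hw ha hwd hww hwz hbal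
    have hc1 := continuousAt_kajiharaSum hp hq hz w (M + 1) hgc (hg0 1 one_ne_zero)
    have hc2 := continuousAt_kajiharaSum hp hq hw z (M + 1) (g := fun s j => (g s j)⁻¹)
      (fun k => (hgc k).inv₀ (hg0 1 one_ne_zero k)) fun k => inv_ne_zero (hg0 1 one_ne_zero k)
    -- A difference at s = 1 would persist on a neighbourhood, which meets the dense complement of
    -- the countable set S.
    by_contra hne
    rw [← hg1] at hne
    have hev := (hc1.sub hc2).eventually_ne (sub_ne_zero.mpr hne)
    have hfr := mem_closure_iff_frequently.mp (hS.dense_compl ℂ 1)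
    obtain ⟨s, hs1, hs2⟩ := (hfr.and_eventually hev).exists
    exact hs2 (sub_eq_zero.mpr (hgeneric s hs1))

end

theorem theorem3p1 (p q : ℂ) (hp : ‖p‖ < 1) (hq : q ≠ 0)
    (m n N : ℕ) (hm : 1 ≤ m) (hn : 1 ≤ n)
    (z : Fin n → ℂ) (w : Fin m → ℂ) (a : Fin (m + n) → ℂ)
    (hz : ∀ k, z k ≠ 0) (hw : ∀ k, w k ≠ 0) (ha : ∀ j, a j ≠ 0)
    -- no denominator occurring in the identity vanishes
    (hΔz : ellDelta p z ≠ 0) (hΔw : ellDelta p w ≠ 0)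
    (hwz : ∀ j k, ellPoch p q (w j * z k) N ≠ 0)
    (hzz : ∀ j k, ellPoch p q (q * z k / z j) N ≠ 0)
    (hww : ∀ j k, ellPoch p q (q * w k / w j) N ≠ 0)
    (hbal : ∏ j, w j = (∏ k, z k) * ∏ j, a j) :
    ∑ y ∈ Finset.Nat.antidiagonalTuple n N,
        ellDelta p (fun k => z k * q ^ y k) / ellDelta p z *
          ∏ k, (∏ j, ellPoch p q (a j * z k) (y k)) /
            ((∏ j, ellPoch p q (w j * z k) (y k)) *
              ∏ j, ellPoch p q (q * z k / z j) (y k)) =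
      ∑ y ∈ Finset.Nat.antidiagonalTuple m N,
        ellDelta p (fun k => w k * q ^ y k) / ellDelta p w *
          ∏ k, (∏ j, ellPoch p q (w k / a j) (y k)) /
            ((∏ j, ellPoch p q (w k * z j) (y k)) *
              ∏ j, ellPoch p q (q * w k / w j) (y k)) := by

  have hk : Fin n := ⟨0, hn⟩
  have hzz' (j k : Fin n) := ellPoch_ne_zero_iff.mp (hzz j k)
  have key := kajiharaSum_eq hp hq (α := Fin (m + n)) (by simp) (by omega) N hz
    ((ellDelta_ne_zero_iff hp hz).mp hΔz) hzz'
    -- The diagonal case of `hzz` says θ(q^(s+1)) ≠ 0 for s < N; it needs one index, hence n ≥ 1.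
    (fun s hs => by
      have := hzz' hk hk s hs
      rwa [mul_div_assoc, div_self (hz hk), mul_one, ← pow_succ'] at this)
    w a hw ha ((ellDelta_ne_zero_iff hp hw).mp hΔw)
    (fun j k => ellPoch_ne_zero_iff.mp (hww j k)) (fun j k => ellPoch_ne_zero_iff.mp (hwz j k)) hbal
  simpa only [kajiharaSum, kajiharaTerm, kajiharaFactor, inv_mul_eq_div, mul_comm (z _) (w _)]
    using key
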